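/- Let $(V,d)$ be a finite metric space with $n=|V|$ points and distances $d:V\times V\to\mathbb{Q}_{\ge 0}$, let $X\subseteq V$ be a set of terminals, $r\in X$ a root, and $k\ge 1$ an integer. A $k$-hop Steiner tree is a tree $T=(V_T,E_T)$, rooted at $r$, with $X\subseteq V_T\subseteq V$, whose edges are pairs of distinct points of $V$ and in which for every $v\in V_T$ the path from $r$ to $v$ has at most $k$ edges; its cost is $\sum_{\{u,v\}\in E_T}d(u,v)$. The metric $d$ is a tree metric if there is an edge-weighted tree with vertex set $V$ such that $d(u,v)$ is the length of the (shortest) path from $u$ to $v$ in it, for all $u,v\in V$. Theorem. On tree metrics, the problem of finding a $k$-hop Steiner tree of minimum cost can be solved exactly in time $n^{O(k)}$. That is, there are a single program (for a random access machine whose unit-cost operations include addition, subtraction and comparison of rational numbers, but no multiplication) and a constant $C$ such that for all $n$ and $k$ and every instance $(V,d,X,r,k)$ for which $d$ is a tree metric, the program, given the distance matrix of $d$, the set $X$, the root $r$ and the integers $n$ and $k$, halts after at most $C\,n^{Ck}$ steps and outputs a $k$-hop Steiner tree of minimum cost. -/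

import Mathlib

namespace KHop

/-! ### The minimum-cost `k`-hop Steiner tree problem -/

/-- An instance: a finite metric space on `n` points `0, …, n - 1` with rational distances
(nonnegativity follows from the three metric laws), a set of terminals, a root among them, and
a hop bound `k ≥ 1`. -/
structure Problem where
  n : ℕ
  dist : Fin n → Fin n → ℚ
  dist_eq_zero : ∀ u v, dist u v = 0 ↔ u = v
  dist_comm : ∀ u v, dist u v = dist v u
  dist_triangle : ∀ u v w, dist u w ≤ dist u v + dist v w
  terminals : Finset (Fin n)
  root : Fin n
  root_mem : root ∈ terminals
  k : ℕ
  one_le_k : 1 ≤ k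

/-- The weighted graph `(G, w)` induces the metric `d`: the weights are nonnegative, and the length
of a shortest `u`-`v` path in `G` equals `d u v`, for all `u`, `v`. -/
def Induces {V : Type*} (G : SimpleGraph V) (w : Sym2 V → ℚ) (d : V → V → ℚ) : Prop :=
  (∀ e ∈ G.edgeSet, 0 ≤ w e) ∧
    ∀ u v, IsLeast {x : ℚ | ∃ p : G.Walk u v, p.IsPath ∧ x = (p.edges.map w).sum} (d u v)

/-- `d` is a tree metric: some weighted tree on the same vertex set induces it. -/
def IsTreeMetric {V : Type*} (d : V → V → ℚ) : Prop :=
  ∃ (G : SimpleGraph V) (w : Sym2 V → ℚ), G.IsTree ∧ Induces G w d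

namespace Problem

variable (I : Problem)

/-- A `k`-hop Steiner tree: a tree `T = (V_T, E_T)` with `V_T ⊆ V` that contains all terminals and
in which every path from the root has at most `k` edges. Its edges are arbitrary pairs
of distinct points of the metric space. -/
structure IsSteinerTree (T : (⊤ : SimpleGraph (Fin I.n)).Subgraph) : Prop where
  isTree : T.coe.IsTree
  terminals_subset : ∀ v ∈ I.terminals, v ∈ T.verts
  depth_le : ∀ (hr : I.root ∈ T.verts) (v : T.verts) (p : T.coe.Walk ⟨I.root, hr⟩ v),
    p.IsPath → p.length ≤ I.k

/-- The cost of an edge is the distance of its endpoints. -/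
def edgeCost : Sym2 (Fin I.n) → ℚ :=
  Sym2.lift ⟨I.dist, I.dist_comm⟩

/-- The cost of a subgraph is the sum of the costs of its edges. -/
noncomputable def cost (T : (⊤ : SimpleGraph (Fin I.n)).Subgraph) : ℚ :=
  ∑ e ∈ (Set.toFinite T.edgeSet).toFinset, I.edgeCost e

/-- `T` is a `k`-hop Steiner tree of minimum cost. -/
def IsOptimal (T : (⊤ : SimpleGraph (Fin I.n)).Subgraph) : Prop :=
  I.IsSteinerTree T ∧ ∀ T', I.IsSteinerTree T' → I.cost T ≤ I.cost T'

end Problem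

/-! ### The machine model

A random access machine with unit-cost instructions, programmed with assignments, sequencing,
conditionals and loops. The memory consists of two-dimensional arrays of natural numbers
and two-dimensional arrays of rational numbers, each named by a natural number, with computed
indices. The arithmetic operations are addition, subtraction and comparison only; there is no
multiplication, division or rounding, so that the natural numbers, and the numerators of
the rational numbers over a fixed common denominator of the input, grow by at most a constant
number of bits per step, and unit cost is a realistic measure. -/

/-- The memory: `nat a i j` and `rat a i j` are the entries `(i, j)` of the arrays named `a`. -/
structure Store where
  nat : ℕ → ℕ → ℕ → ℕ
  rat : ℕ → ℕ → ℕ → ℚ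

namespace Store

/-- Overwrite one entry of an array of natural numbers. -/
def setNat (s : Store) (a i j x : ℕ) : Store where
  nat := fun a' i' j' => if a' = a ∧ i' = i ∧ j' = j then x else s.nat a' i' j'
  rat := s.rat

/-- Overwrite one entry of an array of rational numbers. -/
def setRat (s : Store) (a i j : ℕ) (x : ℚ) : Store where
  nat := s.nat
  rat := fun a' i' j' => if a' = a ∧ i' = i ∧ j' = j then x else s.rat a' i' j'

end Store

/-- Expressions for natural numbers: constants, array entries, sums, truncated differences. -/
inductive NExpr where
  | lit (c : ℕ)
  | get (a : ℕ) (i j : NExpr)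
  | add (e f : NExpr)
  | sub (e f : NExpr)

/-- Expressions for rational numbers: constants, array entries, sums, differences. -/
inductive RExpr where
  | lit (c : ℚ)
  | get (a : ℕ) (i j : NExpr)
  | add (e f : RExpr)
  | sub (e f : RExpr)

/-- Tests: comparisons of two expressions of the same kind, and Boolean combinations. -/
inductive BExpr where
  | nlt (e f : NExpr)
  | rlt (e f : RExpr)
  | neg (b : BExpr)
  | conj (b c : BExpr)

def NExpr.eval (s : Store) : NExpr → ℕ
  | .lit c => c
  | .get a i j => s.nat a (i.eval s) (j.eval s)
  | .add e f => e.eval s + f.eval s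
  | .sub e f => e.eval s - f.eval s

def RExpr.eval (s : Store) : RExpr → ℚ
  | .lit c => c
  | .get a i j => s.rat a (i.eval s) (j.eval s)
  | .add e f => e.eval s + f.eval s
  | .sub e f => e.eval s - f.eval s

def BExpr.Holds (s : Store) : BExpr → Prop
  | .nlt e f => e.eval s < f.eval s
  | .rlt e f => e.eval s < f.eval s
  | .neg b => ¬ b.Holds s
  | .conj b c => b.Holds s ∧ c.Holds s

/-- Programs. `setNat a i j e` is the assignment `a[i, j] := e`. -/
inductive Prog where
  | skip
  | setNat (a : ℕ) (i j e : NExpr)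
  | setRat (a : ℕ) (i j : NExpr) (e : RExpr)
  | seq (p q : Prog)
  | ite (b : BExpr) (p q : Prog)
  | loop (b : BExpr) (p : Prog)

/-- `Exec p s t s'`: started with memory `s`, the program `p` halts after exactly `t` steps with
memory `s'`. Each assignment and each evaluation of a test is one step (the expressions in
a program have constant size). -/
inductive Exec : Prog → Store → ℕ → Store → Prop where
  | skip (s : Store) : Exec .skip s 1 s
  | setNat (a : ℕ) (i j e : NExpr) (s : Store) :
      Exec (.setNat a i j e) s 1 (s.setNat a (i.eval s) (j.eval s) (e.eval s))
  | setRat (a : ℕ) (i j : NExpr) (e : RExpr) (s : Store) :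
      Exec (.setRat a i j e) s 1 (s.setRat a (i.eval s) (j.eval s) (e.eval s))
  | seq {p q : Prog} {s s' s'' : Store} {t t' : ℕ} :
      Exec p s t s' → Exec q s' t' s'' → Exec (.seq p q) s (t + t') s''
  | ite_true {b : BExpr} {p q : Prog} {s s' : Store} {t : ℕ} :
      b.Holds s → Exec p s t s' → Exec (.ite b p q) s (t + 1) s'
  | ite_false {b : BExpr} {p q : Prog} {s s' : Store} {t : ℕ} :
      ¬ b.Holds s → Exec q s t s' → Exec (.ite b p q) s (t + 1) s'
  | loop_true {b : BExpr} {p : Prog} {s s' s'' : Store} {t t' : ℕ} :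
      b.Holds s → Exec p s t s' → Exec (.loop b p) s' t' s'' →
        Exec (.loop b p) s (t + t' + 1) s''
  | loop_false {b : BExpr} {p : Prog} {s : Store} :
      ¬ b.Holds s → Exec (.loop b p) s 1 s

/-! ### Input and output -/

/-- The initial memory for an instance. Arrays of natural numbers: the entry `(0, 0)` of array `0`
is the number of points, of array `1` the hop bound, of array `2` the root, and array `3`
holds the indicator of the terminals in its entries `(v, 0)`. Array `0` of rational numbers
is the distance matrix. Everything else is zero. -/
def Problem.input (I : Problem) : Store where
  nat := fun a i j =>
    if a = 0 ∧ i = 0 ∧ j = 0 then I.n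
    else if a = 1 ∧ i = 0 ∧ j = 0 then I.k
    else if a = 2 ∧ i = 0 ∧ j = 0 then I.root
    else if a = 3 ∧ j = 0 then (if ∃ v ∈ I.terminals, (v : ℕ) = i then 1 else 0)
    else 0
  rat := fun a i j =>
    if h : a = 0 ∧ i < I.n ∧ j < I.n then I.dist ⟨i, h.2.1⟩ ⟨j, h.2.2⟩ else 0

/-- The memory `s` holds the subgraph `T` as output: array `4` of natural numbers holds the
indicator of its vertex set in the entries `(v, 0)`, and array `5` its adjacency matrix. -/
def Problem.IsOutput (I : Problem) (s : Store)
    (T : (⊤ : SimpleGraph (Fin I.n)).Subgraph) : Prop :=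
  (∀ v : Fin I.n, (v ∈ T.verts ∧ s.nat 4 v 0 = 1) ∨ (v ∉ T.verts ∧ s.nat 4 v 0 = 0)) ∧
    ∀ u v : Fin I.n, (T.Adj u v ∧ s.nat 5 u v = 1) ∨ (¬ T.Adj u v ∧ s.nat 5 u v = 0)

end KHop

/-!
A `k`-hop Steiner tree is encoded by giving each point the nearest vertex of depth at most `i`, for
every depth `i`; a vertex of depth `i + 1` is then joined to the nearest vertex of depth at
most `i`. If these data are consistent along every edge of the weighted tree inducing `d`, then
every point that is assigned to some point really is a vertex of the Steiner tree: consistency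
propagates along the path between the two points. So the constraints are local to the edges of
that tree, the cost is a sum over the points, and an optimum is found by eliminating the points
from the leaves to the root, each of them having `n ^ O(k)` states. The program only receives `d`;
the parent of a point `v` in the tree is the nearest point to `v` among those between `v` and
the root.
-/

namespace KHop

/-! ### Tree metrics -/

namespace Induces

variable {V : Type*} {G : SimpleGraph V} {w : Sym2 V → ℚ} {d : V → V → ℚ} {u v x : V}

theorem dist_eq_sum_weights (h : Induces G w d) (hG : G.IsTree) {p : G.Walk u v}
    (hp : p.IsPath) : d u v = (p.edges.map w).sum := by
  obtain ⟨q, hq, hd⟩ := (h.2 u v).1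
  rw [hd, (hG.existsUnique_path u v).unique hp hq]

theorem dist_eq_add_of_mem_support (h : Induces G w d) (hG : G.IsTree) {p : G.Walk u v}
    (hp : p.IsPath) (hx : x ∈ p.support) : d u v = d u x + d x v := by
  classical
  rw [h.dist_eq_sum_weights hG hp, h.dist_eq_sum_weights hG (hp.takeUntil hx),
    h.dist_eq_sum_weights hG (hp.dropUntil hx), ← List.sum_append, ← List.map_append,
    ← SimpleGraph.Walk.edges_append, SimpleGraph.Walk.take_spec]

theorem dist_eq_add_or_of_adj (h : Induces G w d) (hG : G.IsTree) (huv : G.Adj u v) (x : V) :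
    d u x = d u v + d v x ∨ d v x = d v u + d u x := by
  obtain ⟨p, hp, -⟩ := hG.existsUnique_path v x
  by_cases hu : u ∈ p.support
  · exact Or.inr (h.dist_eq_add_of_mem_support hG hp hu)
  · exact Or.inl (h.dist_eq_add_of_mem_support hG (p := .cons huv p) (hp.cons hu) (by simp))

theorem exists_adj_dist_eq_add (h : Induces G w d) (hG : G.IsTree) (hvx : v ≠ x) :
    ∃ u, G.Adj v u ∧ d v x = d v u + d u x := by
  obtain ⟨p, hp, -⟩ := hG.existsUnique_path v x
  cases p with
  | nil => exact absurd rfl hvx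
  | cons hvu q => exact ⟨_, hvu, h.dist_eq_add_of_mem_support hG hp (by simp)⟩

theorem exists_isPath_cons (h : Induces G w d) (hG : G.IsTree) (hcomm : d u v = d v u)
    (hpos : 0 < d v u) (hu : G.Adj v u) (hd : d v x = d v u + d u x) :
    ∃ p : G.Walk u x, (SimpleGraph.Walk.cons hu p).IsPath := by
  obtain ⟨p, hp, -⟩ := hG.existsUnique_path u x
  refine ⟨p, hp.cons fun hv => ?_⟩
  have := h.dist_eq_add_of_mem_support hG hp hv
  linarith

theorem eq_of_adj_of_dist_eq_add (h : Induces G w d) (hG : G.IsTree)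
    (hcomm : ∀ u v, d u v = d v u) (hpos : ∀ u v, u ≠ v → 0 < d u v) {u' : V}
    (hu : G.Adj v u) (hu' : G.Adj v u') (hd : d v x = d v u + d u x)
    (hd' : d v x = d v u' + d u' x) : u = u' := by
  obtain ⟨p, hp⟩ := h.exists_isPath_cons hG (hcomm _ _) (hpos _ _ hu.ne) hu hd
  obtain ⟨p', hp'⟩ := h.exists_isPath_cons hG (hcomm _ _) (hpos _ _ hu'.ne) hu' hd'
  simpa using congrArg SimpleGraph.Walk.snd ((hG.existsUnique_path v x).unique hp hp')

end Induces

/-! ### Arborescences -/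

/-- The arborescences on the vertex set `S` with root `r`: following `parent` from any vertex
leads to the root, because `depth` decreases. The values at `r` and outside `S` are irrelevant. -/
structure IsArborescence {V : Type*} (S : Finset V) (r : V) (parent : V → V) (depth : V → ℕ) :
    Prop where
  root_mem : r ∈ S
  depth_root : depth r = 0
  parent_mem : ∀ v ∈ S, v ≠ r → parent v ∈ S
  depth_parent_lt : ∀ v ∈ S, v ≠ r → depth (parent v) < depth v

namespace IsArborescence

variable {V : Type*} {S : Finset V} {r : V} {parent : V → V} {depth : V → ℕ}

theorem exists_of_connected {G : SimpleGraph V} {T : G.Subgraph}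
    (hS : S = T.verts) (hconn : T.coe.Connected) (hr : r ∈ T.verts) :
    ∃ (parent : V → V) (depth : V → ℕ), IsArborescence S r parent depth ∧
      (∀ v ∈ S, v ≠ r → T.Adj v (parent v)) ∧
      ∀ v (hv : v ∈ T.verts), depth v = T.coe.dist ⟨r, hr⟩ ⟨v, hv⟩ := by
  classical
  have hmem : ∀ {v}, v ∈ S ↔ v ∈ T.verts := by simp [← hS]
  let depth : V → ℕ := fun v => if hv : v ∈ T.verts then T.coe.dist ⟨r, hr⟩ ⟨v, hv⟩ else 0
  have hdepth : ∀ v (hv : v ∈ T.verts), depth v = T.coe.dist ⟨r, hr⟩ ⟨v, hv⟩ :=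
    fun v hv => dif_pos hv
  have hparent : ∀ v, ∃ p, v ∈ S → v ≠ r → T.Adj v p ∧ depth p < depth v := by
    intro v
    by_cases hv : v ∈ T.verts ∧ v ≠ r
    · obtain ⟨q, hq⟩ := hconn.exists_walk_length_eq_dist ⟨v, hv.1⟩ ⟨r, hr⟩
      cases q with
      | nil => exact absurd rfl hv.2
      | @cons _ u _ hvu q =>
        refine ⟨u, fun _ _ => ⟨hvu, ?_⟩⟩
        rw [hdepth v hv.1, hdepth u u.2, T.coe.dist_comm, T.coe.dist_comm (v := ⟨v, hv.1⟩), ← hq]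
        exact Nat.lt_succ_of_le (SimpleGraph.dist_le q)
    · exact ⟨v, fun hS hvr => absurd ⟨hmem.1 hS, hvr⟩ hv⟩
  choose parent hparent using hparent
  exact ⟨parent, depth, ⟨hmem.2 hr, by rw [hdepth r hr, SimpleGraph.dist_self],
    fun v hS hvr => hmem.2 (T.edge_vert (hparent v hS hvr).1.symm),
    fun v hS hvr => (hparent v hS hvr).2⟩, fun v hS hvr => (hparent v hS hvr).1, hdepth⟩

/-- The tree formed by the vertices of an arborescence and the edges to their parents. -/
def toSubgraph (h : IsArborescence S r parent depth) : (⊤ : SimpleGraph V).Subgraph where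
  verts := S
  Adj u v := (u ∈ S ∧ u ≠ r ∧ parent u = v) ∨ (v ∈ S ∧ v ≠ r ∧ parent v = u)
  adj_sub := by
    rintro u v (⟨hS, hr, rfl⟩ | ⟨hS, hr, rfl⟩) heq
    · exact (h.depth_parent_lt u hS hr).ne (by rw [← heq])
    · exact (h.depth_parent_lt v hS hr).ne (by rw [heq])
  edge_vert := by
    rintro u v (⟨hS, -, -⟩ | ⟨hS, hr, rfl⟩)
    exacts [hS, h.parent_mem v hS hr]
  symm := ⟨fun _ _ => Or.symm⟩

variable (h : IsArborescence S r parent depth)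

include h

theorem adj_parent {v : V} (hS : v ∈ S) (hr : v ≠ r) : h.toSubgraph.Adj v (parent v) :=
  Or.inl ⟨hS, hr, rfl⟩

theorem exists_walk_length_le {v : V} (hv : v ∈ S) :
    ∃ q : h.toSubgraph.coe.Walk ⟨r, h.root_mem⟩ ⟨v, hv⟩, q.length ≤ depth v := by
  induction hm : depth v using Nat.strong_induction_on generalizing v with
  | _ m ih =>
    by_cases hr : v = r
    · subst hr
      exact ⟨.nil, Nat.zero_le _⟩
    · have hlt := h.depth_parent_lt v hv hr
      obtain ⟨q, hq⟩ := ih _ (hm ▸ hlt) (h.parent_mem v hv hr) rfl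
      have hadj : h.toSubgraph.coe.Adj ⟨parent v, h.parent_mem v hv hr⟩ ⟨v, hv⟩ :=
        (h.adj_parent hv hr).symm
      refine ⟨q.concat hadj, ?_⟩
      rw [SimpleGraph.Walk.length_concat]
      omega

theorem connected : h.toSubgraph.coe.Connected := by
  have : Nonempty h.toSubgraph.verts := ⟨⟨r, h.root_mem⟩⟩
  refine SimpleGraph.Connected.mk fun u v => ?_
  obtain ⟨p, -⟩ := h.exists_walk_length_le u.2
  obtain ⟨q, -⟩ := h.exists_walk_length_le v.2
  exact ⟨p.reverse.append q⟩

theorem injOn_edge [DecidableEq V] : Set.InjOn (fun v => s(v, parent v)) (S.erase r) := by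
  intro u hu v hv huv
  obtain ⟨hur, huS⟩ := Finset.mem_erase.1 hu
  obtain ⟨hvr, hvS⟩ := Finset.mem_erase.1 hv
  obtain ⟨heq, -⟩ | ⟨huv, hvu⟩ := Sym2.eq_iff.1 huv
  · exact heq
  · have hlt := h.depth_parent_lt u huS hur
    have hlt' := h.depth_parent_lt v hvS hvr
    rw [hvu] at hlt
    rw [← huv] at hlt'
    exact absurd hlt' hlt.asymm

theorem edgeSet_toSubgraph [DecidableEq V] :
    h.toSubgraph.edgeSet = (S.erase r).image (fun v => s(v, parent v)) := by
  ext e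
  induction e using Sym2.ind with
  | _ u v =>
    rw [SimpleGraph.Subgraph.mem_edgeSet, Finset.coe_image]
    constructor
    · rintro (⟨hS, hr, rfl⟩ | ⟨hS, hr, rfl⟩)
      · exact ⟨u, Finset.mem_coe.2 (Finset.mem_erase.2 ⟨hr, hS⟩), rfl⟩
      · exact ⟨v, Finset.mem_coe.2 (Finset.mem_erase.2 ⟨hr, hS⟩), Sym2.eq_swap⟩
    · rintro ⟨x, hx, he⟩
      obtain ⟨hr, hS⟩ := Finset.mem_erase.1 (Finset.mem_coe.1 hx)
      rw [← SimpleGraph.Subgraph.mem_edgeSet, ← he]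
      exact h.adj_parent hS hr

theorem isTree : h.toSubgraph.coe.IsTree := by
  classical
  have : Finite h.toSubgraph.verts := S.finite_toSet
  have hverts : Nat.card h.toSubgraph.verts = S.card := by
    rw [Nat.card_coe_set_eq]
    exact Set.ncard_coe_finset S
  have hedges : Nat.card h.toSubgraph.coe.edgeSet = (S.erase r).card := by
    rw [Nat.card_coe_set_eq,
      ← Set.ncard_image_of_injective _ (Sym2.map.injective Subtype.val_injective),
      SimpleGraph.Subgraph.image_coe_edgeSet_coe, h.edgeSet_toSubgraph, Set.ncard_coe_finset,
      Finset.card_image_of_injOn h.injOn_edge]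
  rw [SimpleGraph.isTree_iff_connected_and_card, hverts, hedges]
  exact ⟨h.connected, Finset.card_erase_add_one h.root_mem⟩

theorem length_le_depth {v : V} (hv : v ∈ S)
    {p : h.toSubgraph.coe.Walk ⟨r, h.root_mem⟩ ⟨v, hv⟩} (hp : p.IsPath) :
    p.length ≤ depth v := by
  classical
  obtain ⟨q, hq⟩ := h.exists_walk_length_le hv
  rw [(h.isTree.existsUnique_path _ _).unique hp q.bypass_isPath]
  exact q.length_bypass_le_length.trans hq

theorem sum_edge_le_sum [DecidableEq V] {f : Sym2 V → ℚ} (hf : ∀ e, 0 ≤ f e) {E : Finset (Sym2 V)}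
    (hE : ∀ v ∈ S, v ≠ r → s(v, parent v) ∈ E) :
    ∑ v ∈ S.erase r, f s(v, parent v) ≤ ∑ e ∈ E, f e := by
  rw [← Finset.sum_image (f := f) h.injOn_edge]
  refine Finset.sum_le_sum_of_subset_of_nonneg (fun e he => ?_) fun e _ _ => hf e
  obtain ⟨v, hv, rfl⟩ := Finset.mem_image.1 he
  exact hE v (Finset.mem_of_mem_erase hv) (Finset.ne_of_mem_erase hv)

end IsArborescence

namespace Problem

variable {I : Problem} {par : Fin I.n → Fin I.n} {v p : Fin I.n}

theorem dist_self (I : Problem) (v : Fin I.n) : I.dist v v = 0 :=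
  (I.dist_eq_zero v v).2 rfl

theorem dist_nonneg (I : Problem) (u v : Fin I.n) : 0 ≤ I.dist u v := by
  have := I.dist_triangle u v u
  rw [I.dist_self, I.dist_comm v u] at this
  linarith

theorem dist_pos (I : Problem) (u v : Fin I.n) (h : u ≠ v) : 0 < I.dist u v :=
  (I.dist_nonneg u v).lt_of_ne fun h0 => h ((I.dist_eq_zero u v).1 h0.symm)

/-! ### Recovering the underlying tree -/

/-- `p` is the parent of `v` in the underlying tree rooted at `I.root`. A program knows this tree
through its metric only, hence the description as the point nearest to `v` among the points other
than `v` on the way from the root to `v`. -/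
structure IsParent (v p : Fin I.n) : Prop where
  ne : p ≠ v
  between : I.dist I.root v = I.dist I.root p + I.dist p v
  closest : ∀ u ≠ v, I.dist I.root v = I.dist I.root u + I.dist u v → I.dist p v ≤ I.dist u v

/-- `par` maps every point other than the root to its parent in the underlying tree. -/
def IsParentMap (I : Problem) (par : Fin I.n → Fin I.n) : Prop :=
  ∀ v ≠ I.root, IsParent v (par v)

section Tree

variable {G : SimpleGraph (Fin I.n)} {w : Sym2 (Fin I.n) → ℚ} {u : Fin I.n}

theorem IsParent.eq_of_adj (hp : IsParent v p) (hG : G.IsTree) (h : Induces G w I.dist)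
    (hvu : G.Adj v u) (hd : I.dist I.root v = I.dist I.root u + I.dist u v) : p = u := by
  have hb := hp.between
  obtain ⟨u', hu', hd'⟩ := h.exists_adj_dist_eq_add hG hp.ne.symm
  have hu'root : I.dist v I.root = I.dist v u' + I.dist u' I.root := by
    refine le_antisymm (I.dist_triangle _ _ _) ?_
    have := I.dist_triangle u' p I.root
    linarith [I.dist_comm v I.root, I.dist_comm p I.root, I.dist_comm p v]
  have huroot : I.dist v I.root = I.dist v u + I.dist u I.root := by
    linarith [I.dist_comm v I.root, I.dist_comm u I.root, I.dist_comm u v]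
  obtain rfl : u' = u :=
    h.eq_of_adj_of_dist_eq_add hG I.dist_comm I.dist_pos hu' hvu hu'root huroot
  have hle : I.dist u' p ≤ 0 := by
    linarith [hp.closest u' hvu.ne' hd, I.dist_comm p v, I.dist_comm u' v]
  exact ((I.dist_eq_zero u' p).1 (hle.antisymm (I.dist_nonneg _ _))).symm

theorem IsParentMap.eq_of_adj (hpar : I.IsParentMap par) (hG : G.IsTree)
    (h : Induces G w I.dist) (hvu : G.Adj v u)
    (hd : I.dist v I.root = I.dist v u + I.dist u I.root) : v ≠ I.root ∧ par v = u := by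
  have hvr : v ≠ I.root := by
    rintro rfl
    linarith [I.dist_self I.root, I.dist_pos I.root u hvu.ne, I.dist_nonneg u I.root]
  refine ⟨hvr, (hpar v hvr).eq_of_adj hG h hvu ?_⟩
  linarith [I.dist_comm v I.root, I.dist_comm u I.root, I.dist_comm u v]

theorem IsParentMap.eq_or_eq_of_adj (hpar : I.IsParentMap par) (hG : G.IsTree)
    (h : Induces G w I.dist) (hvu : G.Adj v u) :
    (v ≠ I.root ∧ par v = u) ∨ (u ≠ I.root ∧ par u = v) :=
  (h.dist_eq_add_or_of_adj hG hvu I.root).imp (hpar.eq_of_adj hG h hvu)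
    (hpar.eq_of_adj hG h hvu.symm)

end Tree

/-! ### Eliminating children before parents -/

/-- The sort key that puts points far from the root first. -/
def key (I : Problem) (v : Fin I.n) : ℚ ×ₗ Fin I.n :=
  toLex (-I.dist I.root v, v)

/-- The position of a point in the order of elimination. -/
def rank (I : Problem) (v : Fin I.n) : ℕ :=
  (Finset.univ.filter fun u => I.key u < I.key v).card

theorem key_lt_key_iff {u v : Fin I.n} : I.key u < I.key v ↔
    I.dist I.root v < I.dist I.root u ∨ I.dist I.root u = I.dist I.root v ∧ u < v := by
  simp only [key, Prod.Lex.toLex_lt_toLex, neg_lt_neg_iff, neg_inj]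

theorem rank_lt_rank {u v : Fin I.n} (h : I.key u < I.key v) : I.rank u < I.rank v := by
  refine Finset.card_lt_card ((Finset.ssubset_iff_of_subset ?_).2 ⟨u, ?_, ?_⟩)
  · exact Finset.monotone_filter_right _ fun w _ hw => lt_trans hw h
  · simpa using h
  · simp

theorem rank_injective (I : Problem) : Function.Injective I.rank := by
  intro u v huv
  obtain h | h | h := lt_trichotomy (I.key u) (I.key v)
  · exact absurd huv (rank_lt_rank h).ne
  · exact congrArg (fun x => (ofLex x).2) h
  · exact absurd huv (rank_lt_rank h).ne'

theorem rank_lt (I : Problem) (v : Fin I.n) : I.rank v < I.n := by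
  have h : I.rank v < Finset.univ.card :=
    Finset.card_lt_card (Finset.filter_ssubset.2 ⟨v, Finset.mem_univ v, lt_irrefl _⟩)
  rwa [Finset.card_fin] at h

theorem exists_rank_eq (I : Problem) {j : ℕ} (hj : j < I.n) : ∃ v, I.rank v = j := by
  have hinj : Function.Injective fun v => (⟨I.rank v, I.rank_lt v⟩ : Fin I.n) :=
    fun u v h => I.rank_injective (congrArg Fin.val h)
  obtain ⟨v, hv⟩ := Finite.surjective_of_injective hinj ⟨j, hj⟩
  exact ⟨v, congrArg Fin.val hv⟩

theorem IsParent.rank_lt (h : IsParent v p) : I.rank v < I.rank p := by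
  refine rank_lt_rank (key_lt_key_iff.2 (Or.inl ?_))
  linarith [h.between, I.dist_pos p v h.ne]

theorem IsParentMap.rank_lt (h : I.IsParentMap par) (hv : v ≠ I.root) :
    I.rank v < I.rank (par v) :=
  (h v hv).rank_lt

end Problem

namespace Problem

variable {I : Problem} {par : Fin I.n → Fin I.n} {σ : Fin I.n → ℕ → Fin I.n} {v : Fin I.n}
  {s : ℕ → Fin I.n}

/-! ### Assignments and their costs -/

/-- The number of depths `0, 1, …` at which a `k`-hop Steiner tree on `n` points can have
vertices. -/
def levels (I : Problem) : ℕ :=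
  min I.k I.n + 1

/-- The depth of `v` in the tree that the state `s` of `v` is meant to describe: `s i` stands for
the tree vertex nearest to `v` among those of depth at most `i`, for all `i < I.levels`, so that the
depth of `v` is the first `i` with `s i = v`. It is `I.levels` if `v` is not in the tree. -/
def label (v : Fin I.n) (s : ℕ → Fin I.n) : ℕ :=
  Nat.find (p := fun i => s i = v ∨ I.levels ≤ i) ⟨I.levels, Or.inr le_rfl⟩

/-- A cost exceeding that of the star with centre `I.root`, charged for each inconsistency. -/
def big (I : Problem) : ℚ :=
  1 + ∑ v, I.dist I.root v

/-- The cost that the state `s` of `v` incurs by itself: the distance to the parent if `v` is in the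
tree. At the root, where the label is `0`, truncated subtraction makes this `I.dist v v = 0`. -/
def vertexCost (v : Fin I.n) (s : ℕ → Fin I.n) : ℚ :=
  if s 0 ≠ I.root then I.big
  else if label v s < I.levels then I.dist v (s (label v s - 1))
  else if v ∈ I.terminals then I.big
  else 0

/-- The states `s` of `v` and `t` of `p` disagree at depth `i` although one of the points assigned
to `v` and `p` is, by the triangle inequality, at least as good a choice for the other one. -/
def Conflict (v p : Fin I.n) (s t : ℕ → Fin I.n) (i : ℕ) : Prop :=
  s i ≠ t i ∧ ¬(I.dist v (s i) < I.dist v p + I.dist p (s i) ∧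
    I.dist p (t i) < I.dist p v + I.dist v (t i))

instance (v p : Fin I.n) (s t : ℕ → Fin I.n) (i : ℕ) : Decidable (Conflict v p s t i) :=
  inferInstanceAs (Decidable (_ ∧ _))

/-- The cost that the states `s` of `v` and `t` of its parent `p` incur by their conflicts. -/
def edgePenalty (v p : Fin I.n) (s t : ℕ → Fin I.n) : ℚ :=
  if v = I.root then 0
  else ∑ i ∈ Finset.range I.levels, if Conflict v p s t i then I.big else 0

/-- The cost of assigning the state `σ v` to every point `v`. -/
def totalCost (par : Fin I.n → Fin I.n) (σ : Fin I.n → ℕ → Fin I.n) : ℚ :=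
  ∑ v, (vertexCost v (σ v) + edgePenalty v (par v) (σ v) (σ (par v)))

theorem levels_le (I : Problem) : I.levels ≤ I.k + 1 :=
  Nat.succ_le_succ (min_le_left _ _)

theorem big_pos (I : Problem) : 0 < I.big :=
  add_pos_of_pos_of_nonneg one_pos (Finset.sum_nonneg fun v _ => I.dist_nonneg I.root v)

theorem label_le_levels (v : Fin I.n) (s : ℕ → Fin I.n) : label v s ≤ I.levels :=
  Nat.find_min' _ (Or.inr le_rfl)

theorem label_le_of_eq {i : ℕ} (h : s i = v) : label v s ≤ i :=
  Nat.find_min' _ (Or.inl h)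

theorem apply_label (h : label v s < I.levels) : s (label v s) = v :=
  (Nat.find_spec (p := fun i => s i = v ∨ I.levels ≤ i) ⟨I.levels, Or.inr le_rfl⟩).resolve_right
    h.not_ge

theorem Conflict.symm {p : Fin I.n} {t : ℕ → Fin I.n} {i : ℕ} (h : Conflict v p s t i) :
    Conflict p v t s i :=
  ⟨h.1.symm, fun h' => h.2 h'.symm⟩

theorem vertexCost_nonneg (v : Fin I.n) (s : ℕ → Fin I.n) : 0 ≤ vertexCost v s := by
  unfold vertexCost
  split_ifs
  exacts [I.big_pos.le, I.dist_nonneg _ _, I.big_pos.le, le_rfl]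

theorem edgePenalty_nonneg (v p : Fin I.n) (s t : ℕ → Fin I.n) : 0 ≤ edgePenalty v p s t := by
  unfold edgePenalty
  split_ifs
  · exact le_rfl
  · exact Finset.sum_nonneg fun i _ => by split_ifs <;> simp [I.big_pos.le]

theorem big_le_edgePenalty {p : Fin I.n} {t : ℕ → Fin I.n} {i : ℕ} (hv : v ≠ I.root)
    (hi : i < I.levels) (h : Conflict v p s t i) : I.big ≤ edgePenalty v p s t := by
  have hterm : ∀ j, 0 ≤ if Conflict v p s t j then I.big else 0 := fun j => by
    split_ifs <;> simp [I.big_pos.le]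
  have hle := Finset.single_le_sum (fun j _ => hterm j) (Finset.mem_range.2 hi)
  rw [if_pos h] at hle
  rwa [edgePenalty, if_neg hv]

theorem edgePenalty_eq_zero {p : Fin I.n} {t : ℕ → Fin I.n}
    (h : ∀ i < I.levels, ¬ Conflict v p s t i) : edgePenalty v p s t = 0 := by
  rw [edgePenalty, Finset.sum_eq_zero fun i hi => if_neg (h i (Finset.mem_range.1 hi)), ite_self]

/-- The assignments that avoid all penalties. -/
structure IsConsistent (par : Fin I.n → Fin I.n) (σ : Fin I.n → ℕ → Fin I.n) : Prop where
  apply_zero : ∀ v, σ v 0 = I.root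
  label_lt : ∀ v ∈ I.terminals, label v (σ v) < I.levels
  not_conflict : ∀ v ≠ I.root, ∀ i < I.levels, ¬ Conflict v (par v) (σ v) (σ (par v)) i

/-- The vertices of the tree that `σ` describes. -/
def used (σ : Fin I.n → ℕ → Fin I.n) : Finset (Fin I.n) :=
  Finset.univ.filter fun v => label v (σ v) < I.levels

/-- The parent of `v` in the tree that `σ` describes: the point assigned to `v` at the depth just
above its own (and `σ I.root 0` for the root). -/
def link (σ : Fin I.n → ℕ → Fin I.n) (v : Fin I.n) : Fin I.n :=
  σ v (label v (σ v) - 1)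

theorem mem_used : v ∈ used σ ↔ label v (σ v) < I.levels := by
  simp only [used, Finset.mem_filter, Finset.mem_univ, true_and]

theorem isConsistent_of_totalCost_lt (h : totalCost par σ < I.big) : I.IsConsistent par σ := by
  have hlt : ∀ v, vertexCost v (σ v) + edgePenalty v (par v) (σ v) (σ (par v)) < I.big :=
    fun v => h.trans_le' (Finset.single_le_sum
      (f := fun v => vertexCost v (σ v) + edgePenalty v (par v) (σ v) (σ (par v)))
      (fun v _ => add_nonneg (vertexCost_nonneg _ _) (edgePenalty_nonneg _ _ _ _))
      (Finset.mem_univ v))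
  have hvertex : ∀ v, vertexCost v (σ v) < I.big := fun v =>
    (hlt v).trans_le' (le_add_of_nonneg_right (edgePenalty_nonneg _ _ _ _))
  have hzero : ∀ v, σ v 0 = I.root := fun v => by
    by_contra hne
    exact (hvertex v).ne (if_pos hne)
  refine ⟨hzero, fun v hv => ?_, fun v hv i hi hc => ?_⟩
  · by_contra hlabel
    refine (hvertex v).ne ?_
    rw [vertexCost, if_neg (not_not.2 (hzero v)), if_neg hlabel, if_pos hv]
  · exact (((big_le_edgePenalty hv hi hc).trans
      (le_add_of_nonneg_left (vertexCost_nonneg _ _))).trans_lt (hlt v)).false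

namespace IsConsistent

variable (hσ : I.IsConsistent par σ)

include hσ

theorem label_root : label I.root (σ I.root) = 0 :=
  Nat.le_zero.1 (label_le_of_eq (hσ.apply_zero I.root))

theorem totalCost_eq : totalCost par σ = ∑ v ∈ (used σ).erase I.root, I.dist v (link σ v) := by
  have hroot : I.dist I.root (link σ I.root) = 0 := by
    rw [link, hσ.label_root, hσ.apply_zero, I.dist_self]
  rw [Finset.sum_erase (f := fun v => I.dist v (link σ v)) _ hroot, used, Finset.sum_filter]
  refine Finset.sum_congr rfl fun v _ => ?_
  have hpen : edgePenalty v (par v) (σ v) (σ (par v)) = 0 := by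
    by_cases hv : v = I.root
    · exact if_pos hv
    · exact edgePenalty_eq_zero (hσ.not_conflict v hv)
  rw [hpen, add_zero, vertexCost, if_neg (not_not.2 (hσ.apply_zero v))]
  split_ifs with hlt hv
  · rfl
  · exact absurd (hσ.label_lt v hv) hlt
  · rfl

end IsConsistent

end Problem

namespace Problem

variable {I : Problem} {par parent : Fin I.n → Fin I.n} {σ : Fin I.n → ℕ → Fin I.n}
  {S : Finset (Fin I.n)} {depth : Fin I.n → ℕ} {v : Fin I.n}

/-! ### From arborescences to Steiner trees and back -/

theorem isSteinerTree_toSubgraph (h : IsArborescence S I.root parent depth)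
    (hterm : I.terminals ⊆ S) (hdepth : ∀ v ∈ S, depth v < I.levels) :
    I.IsSteinerTree h.toSubgraph where
  isTree := h.isTree
  terminals_subset _ hv := hterm hv
  depth_le _ v _ hp := (h.length_le_depth v.2 hp).trans
    (Nat.lt_succ_iff.1 ((hdepth v v.2).trans_le I.levels_le))

theorem cost_toSubgraph (h : IsArborescence S I.root parent depth) :
    I.cost h.toSubgraph = ∑ v ∈ S.erase I.root, I.dist v (parent v) := by
  have hedges : (Set.toFinite h.toSubgraph.edgeSet).toFinset =
      (S.erase I.root).image fun v => s(v, parent v) := by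
    ext e
    rw [Set.Finite.mem_toFinset, h.edgeSet_toSubgraph, Finset.mem_coe]
  rw [cost, hedges, Finset.sum_image h.injOn_edge]
  rfl

theorem edgeCost_nonneg (I : Problem) (e : Sym2 (Fin I.n)) : 0 ≤ I.edgeCost e := by
  induction e using Sym2.ind with
  | _ u v => exact I.dist_nonneg u v

theorem IsSteinerTree.exists_isArborescence {T : (⊤ : SimpleGraph (Fin I.n)).Subgraph}
    (hT : I.IsSteinerTree T) : ∃ S parent depth, IsArborescence S I.root parent depth ∧
      I.terminals ⊆ S ∧ (∀ v ∈ S, depth v < I.levels) ∧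
      ∑ v ∈ S.erase I.root, I.dist v (parent v) ≤ I.cost T := by
  classical
  have hr : I.root ∈ T.verts := hT.terminals_subset _ I.root_mem
  have hS : ((Set.toFinite T.verts).toFinset : Set (Fin I.n)) = T.verts := Set.Finite.coe_toFinset _
  obtain ⟨parent, depth, h, hadj, hdist⟩ :=
    IsArborescence.exists_of_connected hS hT.isTree.connected hr
  refine ⟨_, parent, depth, h, fun v hv => ?_, fun v hv => ?_, ?_⟩
  · exact (Set.Finite.mem_toFinset _).2 (hT.terminals_subset v hv)
  · have hv : v ∈ T.verts := (Set.Finite.mem_toFinset _).1 hv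
    obtain ⟨p, hp, hlen⟩ := hT.isTree.connected.exists_path_of_dist ⟨I.root, hr⟩ ⟨v, hv⟩
    have hcard : Nat.card T.verts ≤ I.n := by
      simpa using Nat.card_le_card_of_injective _ (Subtype.val_injective (p := (· ∈ T.verts)))
    rw [hdist v hv, ← hlen, levels, Nat.lt_succ_iff, le_min_iff]
    refine ⟨hT.depth_le hr _ p hp, ?_⟩
    rw [Nat.card_eq_fintype_card] at hcard
    exact hp.length_lt.le.trans hcard
  · refine h.sum_edge_le_sum (f := I.edgeCost) I.edgeCost_nonneg fun v hv hvr => ?_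
    exact (Set.Finite.mem_toFinset _).2 (hadj v hv hvr)

/-! ### Consistent assignments describe Steiner trees -/

theorem IsConsistent.not_conflict_of_adj (hσ : I.IsConsistent par σ) (hpar : I.IsParentMap par)
    {G : SimpleGraph (Fin I.n)} {w : Sym2 (Fin I.n) → ℚ} (hG : G.IsTree) (h : Induces G w I.dist)
    {u : Fin I.n} (hvu : G.Adj v u) {i : ℕ} (hi : i < I.levels) :
    ¬ Conflict v u (σ v) (σ u) i := by
  obtain ⟨hr, rfl⟩ | ⟨hr, rfl⟩ := hpar.eq_or_eq_of_adj hG h hvu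
  · exact hσ.not_conflict v hr i hi
  · exact fun hc => hσ.not_conflict u hr i hi hc.symm

/-- Along the path of the underlying tree from `v` to the point assigned to `v`, the first step off
this point would be a conflict. -/
theorem IsConsistent.apply_apply (hσ : I.IsConsistent par σ) (hpar : I.IsParentMap par)
    (ht : IsTreeMetric I.dist) {i : ℕ} (hi : i < I.levels) : σ (σ v i) i = σ v i := by
  obtain ⟨G, w, hG, h⟩ := ht
  suffices ∀ {u x : Fin I.n} (p : G.Walk u x), p.IsPath → σ u i = x → σ x i = x by
    obtain ⟨p, hp, -⟩ := hG.existsUnique_path v (σ v i)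
    exact this p hp rfl
  intro u x p hp hux
  induction p with
  | nil => exact hux
  | @cons u u' x huu' p ih =>
    refine ih hp.of_cons ?_
    by_contra hne
    refine hσ.not_conflict_of_adj hpar hG h huu' hi ⟨fun heq => hne (heq ▸ hux), fun hlt => ?_⟩
    have hd : I.dist u x = I.dist u u' + I.dist u' x :=
      h.dist_eq_add_of_mem_support hG hp (by simp)
    exact hlt.1.ne (hux ▸ hd)

theorem IsConsistent.isArborescence (hσ : I.IsConsistent par σ) (hpar : I.IsParentMap par)
    (ht : IsTreeMetric I.dist) :
    IsArborescence (used σ) I.root (link σ) (fun v => label v (σ v)) := by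
  have hlink : ∀ v ∈ used σ, v ≠ I.root →
      label (link σ v) (σ (link σ v)) < label v (σ v) := by
    intro v hv hr
    have hlt := mem_used.1 hv
    have hpos : label v (σ v) ≠ 0 := fun h0 => hr (by
      rw [← apply_label hlt, h0, hσ.apply_zero])
    have hle := label_le_of_eq (hσ.apply_apply (v := v) hpar ht (i := label v (σ v) - 1) (by omega))
    exact hle.trans_lt (by omega)
  have hroot := hσ.label_root
  exact ⟨mem_used.2 (hroot ▸ Nat.succ_pos _), hroot,
    fun v hv hr => mem_used.2 ((hlink v hv hr).trans (mem_used.1 hv)), hlink⟩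

/-! ### Steiner trees give consistent assignments -/

/-- `x` is the point of `L` nearest to `v`, ties being broken by the numbering of the points. -/
structure IsNearest (L : Finset (Fin I.n)) (v x : Fin I.n) : Prop where
  mem : x ∈ L
  dist_le : ∀ y ∈ L, I.dist v x ≤ I.dist v y
  le : ∀ y ∈ L, I.dist v x = I.dist v y → x ≤ y

section IsNearest

variable {L : Finset (Fin I.n)} {u x y : Fin I.n}

theorem exists_isNearest (hL : L.Nonempty) (v : Fin I.n) : ∃ x, IsNearest L v x := by
  obtain ⟨x, hx, hmin⟩ := Finset.exists_min_image L (fun x => toLex (I.dist v x, x)) hL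
  refine ⟨x, hx, fun y hy => ?_, fun y hy heq => ?_⟩ <;>
    rcases Prod.Lex.toLex_le_toLex.1 (hmin y hy) with hlt | ⟨heq', hle⟩
  exacts [hlt.le, heq'.le, absurd heq hlt.ne, hle]

theorem IsNearest.eq_self (h : IsNearest L v x) (hv : v ∈ L) : x = v := by
  have hle := h.dist_le v hv
  rw [I.dist_self] at hle
  exact ((I.dist_eq_zero v x).1 (hle.antisymm (I.dist_nonneg v x))).symm

theorem IsNearest.eq_of_dist_add_le (hx : IsNearest L u x) (hy : IsNearest L v y)
    (h : I.dist u v + I.dist v x ≤ I.dist u x) : x = y := by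
  have hxy := hx.dist_le y hy.mem
  have hyx := hy.dist_le x hx.mem
  have htri := I.dist_triangle u v y
  exact le_antisymm (hx.le y hy.mem (by linarith)) (hy.le x hx.mem (by linarith))

theorem IsNearest.not_conflict {s t : ℕ → Fin I.n} {i : ℕ} (hx : IsNearest L u (s i))
    (hy : IsNearest L v (t i)) : ¬ Conflict u v s t i := by
  rintro ⟨hne, hlt⟩
  refine hlt ⟨?_, ?_⟩
  · by_contra hle
    exact hne (hx.eq_of_dist_add_le hy (not_lt.1 hle))
  · by_contra hle
    exact hne (hy.eq_of_dist_add_le hx (not_lt.1 hle)).symm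

end IsNearest

section Nearest

variable {s : ℕ → Fin I.n} (hs : ∀ i < I.levels, IsNearest (S.filter (depth · ≤ i)) v (s i))

include hs

theorem apply_zero_of_isNearest (h : IsArborescence S I.root parent depth) : s 0 = I.root := by
  obtain ⟨hS, hle⟩ := Finset.mem_filter.1 (hs 0 (Nat.succ_pos _)).mem
  by_contra hne
  exact absurd (h.depth_parent_lt _ hS hne) (by omega)

theorem label_of_isNearest (hdepth : ∀ v ∈ S, depth v < I.levels) :
    label v s = if v ∈ S then depth v else I.levels := by
  have hmem : label v s < I.levels → v ∈ S ∧ depth v ≤ label v s := fun hlt => by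
    have hmem := (hs _ hlt).mem
    rwa [apply_label hlt, Finset.mem_filter] at hmem
  split_ifs with hv
  · have hself := (hs _ (hdepth v hv)).eq_self (Finset.mem_filter.2 ⟨hv, le_rfl⟩)
    have hle := label_le_of_eq hself
    exact hle.antisymm (hmem (hle.trans_lt (hdepth v hv))).2
  · exact (label_le_levels v s).eq_of_not_lt fun hlt => hv (hmem hlt).1

theorem vertexCost_le_of_isNearest (h : IsArborescence S I.root parent depth)
    (hterm : I.terminals ⊆ S) (hdepth : ∀ v ∈ S, depth v < I.levels) :
    vertexCost v s ≤ if v ∈ S.erase I.root then I.dist v (parent v) else 0 := by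
  have hzero := apply_zero_of_isNearest hs h
  rw [vertexCost, if_neg (not_not.2 hzero), label_of_isNearest hs hdepth]
  by_cases hv : v ∈ S
  · rw [if_pos hv, if_pos (hdepth v hv)]
    by_cases hr : v = I.root
    · subst hr
      rw [h.depth_root, hzero, if_neg (Finset.notMem_erase _ _), I.dist_self]
    · have hlt := h.depth_parent_lt v hv hr
      rw [if_pos (Finset.mem_erase.2 ⟨hr, hv⟩)]
      exact (hs _ ((Nat.sub_le _ _).trans_lt (hdepth v hv))).dist_le _
        (Finset.mem_filter.2 ⟨h.parent_mem v hv hr, by omega⟩)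
  · rw [if_neg hv, if_neg (lt_irrefl _), if_neg (mt (@hterm v) hv),
      if_neg (mt Finset.mem_of_mem_erase hv)]

end Nearest

theorem totalCost_le_of_isNearest (h : IsArborescence S I.root parent depth)
    (hterm : I.terminals ⊆ S) (hdepth : ∀ v ∈ S, depth v < I.levels)
    (hσ : ∀ v, ∀ i < I.levels, IsNearest (S.filter (depth · ≤ i)) v (σ v i)) :
    totalCost par σ ≤ ∑ v ∈ S.erase I.root, I.dist v (parent v) := by
  have hpen : ∀ v, edgePenalty v (par v) (σ v) (σ (par v)) = 0 := fun v =>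
    edgePenalty_eq_zero fun i hi => (hσ v i hi).not_conflict (hσ (par v) i hi)
  rw [totalCost, ← Finset.univ_inter (S.erase I.root), ← Finset.sum_ite_mem]
  refine Finset.sum_le_sum fun v _ => ?_
  rw [hpen, add_zero]
  exact vertexCost_le_of_isNearest (hσ v) h hterm hdepth

/-! ### States coded by numbers -/

/-- The number of sequences of `I.levels` points. -/
def numStates (I : Problem) : ℕ :=
  I.n ^ I.levels

/-- The sequence of points that `x` codes in base `I.n`, the least significant digit first. -/
def state (I : Problem) (x i : ℕ) : Fin I.n :=
  ⟨x / I.n ^ i % I.n, Nat.mod_lt _ (Fin.pos I.root)⟩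

theorem exists_state_eq (f : ℕ → Fin I.n) :
    ∃ x < I.numStates, ∀ i < I.levels, I.state x i = f i := by
  let g : Fin I.levels → Fin I.n := fun i => f i
  exact ⟨finFunctionFinEquiv g, (finFunctionFinEquiv g).2, fun i hi =>
    congrFun (finFunctionFinEquiv.symm_apply_apply g) ⟨i, hi⟩⟩

theorem exists_totalCost_le_of_isArborescence (par : Fin I.n → Fin I.n)
    (h : IsArborescence S I.root parent depth) (hterm : I.terminals ⊆ S)
    (hdepth : ∀ v ∈ S, depth v < I.levels) :
    ∃ τ : Fin I.n → ℕ, (∀ v, τ v < I.numStates) ∧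
      totalCost par (fun v => I.state (τ v)) ≤ ∑ v ∈ S.erase I.root, I.dist v (parent v) := by
  have hroot : ∀ i, (S.filter (depth · ≤ i)).Nonempty := fun i =>
    ⟨I.root, Finset.mem_filter.2 ⟨h.root_mem, h.depth_root.trans_le (Nat.zero_le i)⟩⟩
  choose nearest hnearest using fun v i => exists_isNearest (hroot i) v
  choose τ hτ hstate using fun v => exists_state_eq (nearest v)
  refine ⟨τ, hτ, totalCost_le_of_isNearest h hterm hdepth fun v i hi => ?_⟩
  rw [hstate v i hi]
  exact hnearest v i

theorem isArborescence_star (I : Problem) : IsArborescence Finset.univ I.root (fun _ => I.root)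
    (fun v => if v = I.root then 0 else 1) where
  root_mem := Finset.mem_univ _
  depth_root := if_pos rfl
  parent_mem _ _ _ := Finset.mem_univ _
  depth_parent_lt v _ hv := by simp only [if_true, if_neg hv, zero_lt_one]

theorem exists_totalCost_lt_big (par : Fin I.n → Fin I.n) :
    ∃ τ : Fin I.n → ℕ, (∀ v, τ v < I.numStates) ∧
      totalCost par (fun v => I.state (τ v)) < I.big := by
  have hn := Fin.pos I.root
  have hk := I.one_le_k
  obtain ⟨τ, hτ, hle⟩ := exists_totalCost_le_of_isArborescence par I.isArborescence_star
    (Finset.subset_univ _) fun v _ => by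
      rw [levels]
      split_ifs <;> omega
  refine ⟨τ, hτ, hle.trans_lt ?_⟩
  rw [Finset.sum_erase (f := fun v => I.dist v I.root) _ (I.dist_self _), big]
  simp only [I.dist_comm _ I.root, lt_add_iff_pos_left, zero_lt_one]

theorem isOptimal_of_forall_totalCost_le (hpar : I.IsParentMap par) (ht : IsTreeMetric I.dist)
    (hmin : ∀ τ : Fin I.n → ℕ, (∀ v, τ v < I.numStates) →
      totalCost par σ ≤ totalCost par (fun v => I.state (τ v))) :
    ∃ h : IsArborescence (used σ) I.root (link σ) (fun v => label v (σ v)),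
      I.IsOptimal h.toSubgraph := by
  obtain ⟨τ, hτ, hlt⟩ := exists_totalCost_lt_big par
  have hσ : I.IsConsistent par σ := isConsistent_of_totalCost_lt ((hmin τ hτ).trans_lt hlt)
  have h := hσ.isArborescence hpar ht
  refine ⟨h, isSteinerTree_toSubgraph h (fun v hv => mem_used.2 (hσ.label_lt v hv))
    fun v hv => mem_used.1 hv, fun T' hT' => ?_⟩
  obtain ⟨S, parent, depth, h', hterm, hdepth, hcost⟩ := hT'.exists_isArborescence
  obtain ⟨τ', hτ', hle⟩ := exists_totalCost_le_of_isArborescence par h' hterm hdepth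
  rw [cost_toSubgraph, ← hσ.totalCost_eq]
  exact (hmin τ' hτ').trans (hle.trans hcost)

end Problem

/-! ### Dynamic programming on a tree -/

/-- The vertex `v` of a tree with root `r` has been eliminated, in minimizing
`∑ v, (f v (τ v) + g v (τ v) (τ (par v)))` over all `τ` with values in `A` from the leaves to the
root: `table v x` is the least cost of the subtree of `v` if `v` has state `x`, and `msg v x` is the
least cost of this subtree and the edge to the parent if the parent has state `x`, attained at the
state `best v x` of `v`. -/
structure IsEliminated {ι α R : Type*} [Fintype ι] [DecidableEq ι] [AddCommGroup R] [LE R]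
    (par : ι → ι) (r : ι) (A : Set α) (f : ι → α → R) (g : ι → α → α → R)
    (table : ι → α → R) (best : ι → α → α) (msg : ι → α → R) (v : ι) : Prop where
  best_mem : ∀ x ∈ A, best v x ∈ A
  table_eq : ∀ x ∈ A, table v x = f v x + ∑ c ∈ Finset.univ.erase r with par c = v, msg c x
  msg_eq : ∀ x ∈ A, msg v x = table v (best v x) + g v (best v x) x
  msg_le : ∀ x ∈ A, ∀ y ∈ A, msg v x ≤ table v y + g v y x

namespace IsEliminated

variable {ι α R : Type*} [Fintype ι] [DecidableEq ι] [AddCommGroup R] [PartialOrder R]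
  {par : ι → ι} {r : ι} {A : Set α} {f : ι → α → R} {g : ι → α → α → R}
  {table table' : ι → α → R} {best best' : ι → α → α} {msg msg' : ι → α → R} {τ : ι → α}

theorem congr {v : ι} (h : IsEliminated par r A f g table best msg v)
    (htable : ∀ x, table' v x = table v x) (hbest : ∀ x, best' v x = best v x)
    (hmsg : ∀ x, msg' v x = msg v x) (hchild : ∀ c ≠ r, par c = v → ∀ x, msg' c x = msg c x) :
    IsEliminated par r A f g table' best' msg' v where
  best_mem x hx := hbest x ▸ h.best_mem x hx
  table_eq x hx := by
    rw [htable, h.table_eq x hx]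
    congr 1
    refine Finset.sum_congr rfl fun c hc => (hchild c ?_ (Finset.mem_filter.1 hc).2 x).symm
    exact Finset.ne_of_mem_erase (Finset.mem_filter.1 hc).1
  msg_eq x hx := by rw [hmsg, hbest, htable, h.msg_eq x hx]
  msg_le x hx y hy := by rw [hmsg, htable]; exact h.msg_le x hx y hy

variable (h : ∀ v, IsEliminated par r A f g table best msg v) (hg : ∀ x y, g r x y = 0)

include h hg

theorem sum_eq (hτ : ∀ v, τ v ∈ A) : ∑ v, (f v (τ v) + g v (τ v) (τ (par v))) =
    table r (τ r) + ∑ v ∈ Finset.univ.erase r,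
      (table v (τ v) + g v (τ v) (τ (par v)) - msg v (τ (par v))) := by
  have hmsg : ∑ v, ∑ c ∈ Finset.univ.erase r with par c = v, msg c (τ v) =
      ∑ c ∈ Finset.univ.erase r, msg c (τ (par c)) := by
    rw [← Finset.sum_fiberwise (Finset.univ.erase r) par]
    refine Finset.sum_congr rfl fun v _ => Finset.sum_congr rfl fun c hc => ?_
    rw [(Finset.mem_filter.1 hc).2]
  have hroot : table r (τ r) = table r (τ r) + g r (τ r) (τ (par r)) := by rw [hg, add_zero]
  rw [Finset.sum_sub_distrib, ← hmsg, ← add_sub_assoc, hroot,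
    Finset.add_sum_erase _ (fun v => table v (τ v) + g v (τ v) (τ (par v))) (Finset.mem_univ r),
    ← Finset.sum_sub_distrib]
  refine Finset.sum_congr rfl fun v _ => ?_
  rw [(h v).table_eq _ (hτ v)]
  abel

theorem sum_le_sum [IsOrderedAddMonoid R] {x : α} (hx : x ∈ A) (hr : τ r = best r x)
    (hτ : ∀ v ≠ r, τ v = best v (τ (par v))) (hmem : ∀ v, τ v ∈ A) {τ' : ι → α}
    (hmem' : ∀ v, τ' v ∈ A) : ∑ v, (f v (τ v) + g v (τ v) (τ (par v))) ≤
      ∑ v, (f v (τ' v) + g v (τ' v) (τ' (par v))) := by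
  have hopt : ∀ v ∈ Finset.univ.erase r,
      table v (τ v) + g v (τ v) (τ (par v)) - msg v (τ (par v)) = 0 := fun v hv => by
    rw [(h v).msg_eq _ (hmem _), ← hτ v (Finset.ne_of_mem_erase hv), sub_self]
  have hroot : table r (τ r) = msg r x := by rw [(h r).msg_eq x hx, hg, add_zero, hr]
  rw [sum_eq h hg hmem, sum_eq h hg hmem', Finset.sum_eq_zero hopt, hroot]
  refine add_le_add ?_ (Finset.sum_nonneg fun v _ =>
    sub_nonneg.2 ((h v).msg_le _ (hmem' _) _ (hmem' _)))
  simpa only [hg, add_zero] using (h r).msg_le x hx _ (hmem' r)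

end IsEliminated

/-! ### Reasoning about programs -/

/-- A bound for the number of steps of a program all of whose loops make at most `B` iterations
whenever they are entered. -/
def Prog.time (B : ℕ) : Prog → ℕ
  | .skip => 1
  | .setNat _ _ _ _ => 1
  | .setRat _ _ _ _ => 1
  | .seq p q => p.time B + q.time B
  | .ite _ p q => p.time B + q.time B + 1
  | .loop _ p => B * (p.time B + 1) + 1

theorem Prog.exists_time_le (p : Prog) : ∃ C, ∀ B ≥ 1, p.time B ≤ C * B ^ C := by
  have hmono : ∀ {B C D : ℕ}, B ≥ 1 → C ≤ D → B ^ C ≤ B ^ D := fun hB h =>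
    Nat.pow_le_pow_right hB h
  induction p with
  | skip => exact ⟨1, fun B hB => by simpa [time] using hB⟩
  | setNat => exact ⟨1, fun B hB => by simpa [time] using hB⟩
  | setRat => exact ⟨1, fun B hB => by simpa [time] using hB⟩
  | seq p q ihp ihq =>
    obtain ⟨C, hC⟩ := ihp
    obtain ⟨D, hD⟩ := ihq
    refine ⟨C + D, fun B hB => ?_⟩
    have hCD := hmono hB (Nat.le_add_right C D)
    have hDC := hmono hB (Nat.le_add_left D C)
    rw [time]
    nlinarith [hC B hB, hD B hB]
  | ite b p q ihp ihq =>
    obtain ⟨C, hC⟩ := ihp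
    obtain ⟨D, hD⟩ := ihq
    refine ⟨C + D + 1, fun B hB => ?_⟩
    have hCD := hmono hB (show C ≤ C + D + 1 by omega)
    have hDC := hmono hB (show D ≤ C + D + 1 by omega)
    have hone := hmono hB (Nat.zero_le (C + D + 1))
    rw [time]
    nlinarith [hC B hB, hD B hB]
  | loop b p ih =>
    obtain ⟨C, hC⟩ := ih
    refine ⟨C + 2, fun B hB => ?_⟩
    have hC' := hmono hB (Nat.le_succ (C + 1))
    have hone := hmono hB (Nat.zero_le (C + 2))
    have hB' := hmono hB (show 1 ≤ C + 2 by omega)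
    calc B * (p.time B + 1) + 1 ≤ B * (C * B ^ C + 1) + 1 := by gcongr; exact hC B hB
      _ = C * B ^ (C + 1) + B ^ 1 + B ^ 0 := by ring
      _ ≤ C * B ^ (C + 2) + B ^ (C + 2) + B ^ (C + 2) := by gcongr
      _ = (C + 2) * B ^ (C + 2) := by ring

/-- `p` contains no assignment to the array `a` of natural numbers. -/
def Prog.keepsNat (a : ℕ) : Prog → Bool
  | .skip => true
  | .setNat b _ _ _ => b != a
  | .setRat _ _ _ _ => true
  | .seq p q => p.keepsNat a && q.keepsNat a
  | .ite _ p q => p.keepsNat a && q.keepsNat a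
  | .loop _ p => p.keepsNat a

/-- `p` contains no assignment to the array `a` of rational numbers. -/
def Prog.keepsRat (a : ℕ) : Prog → Bool
  | .skip => true
  | .setNat _ _ _ _ => true
  | .setRat b _ _ _ => b != a
  | .seq p q => p.keepsRat a && q.keepsRat a
  | .ite _ p q => p.keepsRat a && q.keepsRat a
  | .loop _ p => p.keepsRat a

/-- The memories `s` and `s'` agree on the arrays that `p` does not assign to. -/
structure Agree (p : Prog) (s s' : Store) : Prop where
  nat : ∀ {a}, p.keepsNat a = true → ∀ i j, s'.nat a i j = s.nat a i j
  rat : ∀ {a}, p.keepsRat a = true → ∀ i j, s'.rat a i j = s.rat a i j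

namespace Agree

variable {p q : Prog} {s s' s'' : Store}

theorem refl (p : Prog) (s : Store) : Agree p s s :=
  ⟨fun _ _ _ => rfl, fun _ _ _ => rfl⟩

theorem trans (h : Agree p s s') (h' : Agree p s' s'') : Agree p s s'' :=
  ⟨fun ha i j => (h'.nat ha i j).trans (h.nat ha i j),
    fun ha i j => (h'.rat ha i j).trans (h.rat ha i j)⟩

theorem mono (h : Agree p s s') (hnat : ∀ a, q.keepsNat a = true → p.keepsNat a = true)
    (hrat : ∀ a, q.keepsRat a = true → p.keepsRat a = true) : Agree q s s' :=
  ⟨fun ha => h.nat (hnat _ ha), fun ha => h.rat (hrat _ ha)⟩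

theorem seq_left (h : Agree p s s') : Agree (.seq p q) s s' :=
  h.mono (fun _ ha => (Bool.and_eq_true_iff.1 ha).1) fun _ ha => (Bool.and_eq_true_iff.1 ha).1

theorem seq_right (h : Agree q s s') : Agree (.seq p q) s s' :=
  h.mono (fun _ ha => (Bool.and_eq_true_iff.1 ha).2) fun _ ha => (Bool.and_eq_true_iff.1 ha).2

end Agree

theorem Exec.agree {p : Prog} {s s' : Store} {t : ℕ} (h : Exec p s t s') : Agree p s s' := by
  induction h with
  | skip s => exact .refl _ s
  | setNat a i j e s =>
    exact ⟨fun hb _ _ => if_neg fun h => bne_iff_ne.1 hb h.1.symm, fun _ _ _ => rfl⟩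
  | setRat a i j e s =>
    exact ⟨fun _ _ _ => rfl, fun hb _ _ => if_neg fun h => bne_iff_ne.1 hb h.1.symm⟩
  | seq _ _ h h' => exact h.seq_left.trans h'.seq_right
  | ite_true _ _ h => exact h.seq_left.mono (fun _ => id) fun _ => id
  | ite_false _ _ h => exact h.seq_right.mono (fun _ => id) fun _ => id
  | loop_true _ _ _ h h' => exact Agree.trans (h.mono (fun _ => id) fun _ => id) h'
  | loop_false _ => exact .refl _ _

/-- Started in the memory `s`, the program `p` halts in a memory satisfying `Q`, within the time
allowed if all loops make at most `B` iterations. -/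
def Runs (B : ℕ) (p : Prog) (s : Store) (Q : Store → Prop) : Prop :=
  ∃ t s', Exec p s t s' ∧ t ≤ p.time B ∧ Q s'

namespace Runs

variable {B : ℕ} {p q : Prog} {s : Store} {Q R : Store → Prop}

theorem mono (h : Runs B p s Q) (hQ : ∀ s', Agree p s s' → Q s' → R s') : Runs B p s R := by
  obtain ⟨t, s', hexec, htime, hs'⟩ := h
  exact ⟨t, s', hexec, htime, hQ s' hexec.agree hs'⟩

theorem skip (h : Q s) : Runs B .skip s Q :=
  ⟨1, s, .skip s, le_rfl, h⟩

theorem setNat {a : ℕ} {i j e : NExpr} {x y z : ℕ} (hi : i.eval s = x) (hj : j.eval s = y)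
    (he : e.eval s = z) : Runs B (.setNat a i j e) s fun s' => s'.nat a x y = z ∧
      ∀ x' y', (x' ≠ x ∨ y' ≠ y) → s'.nat a x' y' = s.nat a x' y' :=
  ⟨1, _, .setNat a i j e s, le_rfl, by simp only [Store.setNat, hi, hj, he, and_self, if_true],
    fun x' y' h => if_neg fun h' => h.elim (· (h'.2.1.trans hi)) (· (h'.2.2.trans hj))⟩

theorem setRat {a : ℕ} {i j : NExpr} {e : RExpr} {x y : ℕ} {z : ℚ} (hi : i.eval s = x)
    (hj : j.eval s = y) (he : e.eval s = z) : Runs B (.setRat a i j e) s fun s' =>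
      s'.rat a x y = z ∧ ∀ x' y', (x' ≠ x ∨ y' ≠ y) → s'.rat a x' y' = s.rat a x' y' :=
  ⟨1, _, .setRat a i j e s, le_rfl, by simp only [Store.setRat, hi, hj, he, and_self, if_true],
    fun x' y' h => if_neg fun h' => h.elim (· (h'.2.1.trans hi)) (· (h'.2.2.trans hj))⟩

theorem seq (h : Runs B p s R) (h' : ∀ s', Agree p s s' → R s' → Runs B q s' Q) :
    Runs B (.seq p q) s Q := by
  obtain ⟨t, s', hexec, htime, hs'⟩ := h
  obtain ⟨t', s'', hexec', htime', hs''⟩ := h' s' hexec.agree hs'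
  exact ⟨t + t', s'', .seq hexec hexec', Nat.add_le_add htime htime', hs''⟩

theorem ite {b : BExpr} (h : b.Holds s → Runs B p s Q) (h' : ¬ b.Holds s → Runs B q s Q) :
    Runs B (.ite b p q) s Q := by
  by_cases hb : b.Holds s
  · obtain ⟨t, s', hexec, htime, hs'⟩ := h hb
    exact ⟨t + 1, s', .ite_true hb hexec, by rw [Prog.time]; omega, hs'⟩
  · obtain ⟨t, s', hexec, htime, hs'⟩ := h' hb
    exact ⟨t + 1, s', .ite_false hb hexec, by rw [Prog.time]; omega, hs'⟩

end Runs

/-- The scalar variable held in the entry `(0, 0)` of the array `a`. -/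
abbrev var (a : ℕ) : NExpr := .get a (.lit 0) (.lit 0)

/-- The rational scalar variable held in the entry `(0, 0)` of the array `a`. -/
abbrev ratVar (a : ℕ) : RExpr := .get a (.lit 0) (.lit 0)

/-- Assignment to a scalar variable. -/
abbrev assign (a : ℕ) (e : NExpr) : Prog := .setNat a (.lit 0) (.lit 0) e

/-- Assignment to a rational scalar variable. -/
abbrev assignRat (a : ℕ) (e : RExpr) : Prog := .setRat a (.lit 0) (.lit 0) e

/-- Adding one to a scalar variable. -/
abbrev increment (a : ℕ) : Prog := assign a (.add (var a) (.lit 1))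

theorem Runs.assign {B a z : ℕ} {e : NExpr} {s : Store} (he : e.eval s = z) :
    Runs B (assign a e) s fun s' => s'.nat a 0 0 = z :=
  (Runs.setNat rfl rfl he).mono fun _ _ h => h.1

theorem Runs.assignRat {B a : ℕ} {e : RExpr} {s : Store} {z : ℚ} (he : e.eval s = z) :
    Runs B (assignRat a e) s fun s' => s'.rat a 0 0 = z :=
  (Runs.setRat rfl rfl he).mono fun _ _ h => h.1

/-- The loop `for c := 0 to N - 1 do p`, where the counter `c` and the bound `N` are scalar
variables that `p` does not change. -/
def forLoop (c N : ℕ) (p : Prog) : Prog :=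
  .seq (assign c (.lit 0)) (.loop (.nlt (var c) (var N)) (.seq p (increment c)))

namespace Runs

variable {B c N m : ℕ} {p : Prog} {s₀ : Store}

theorem loop {b : BExpr} (Inv : ℕ → Store → Prop) (hm : m ≤ B) (h0 : Inv 0 s₀)
    (hb : ∀ j ≤ m, ∀ s, Agree p s₀ s → Inv j s → (b.Holds s ↔ j < m))
    (hstep : ∀ j < m, ∀ s, Agree p s₀ s → Inv j s → Runs B p s (Inv (j + 1))) :
    Runs B (.loop b p) s₀ (Inv m) := by
  suffices ∀ r j, j + r = m → ∀ s, Agree p s₀ s → Inv j s →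
      ∃ t s', Exec (.loop b p) s t s' ∧ t ≤ r * (p.time B + 1) + 1 ∧ Inv m s' by
    obtain ⟨t, s', hexec, htime, hs'⟩ := this m 0 (Nat.zero_add m) s₀ (.refl p s₀) h0
    refine ⟨t, s', hexec, htime.trans ?_, hs'⟩
    rw [Prog.time]
    gcongr
  intro r
  induction r with
  | zero =>
    rintro j rfl s hs hInv
    exact ⟨1, s, .loop_false fun h => lt_irrefl _ ((hb _ le_rfl s hs hInv).1 h), by omega, hInv⟩
  | succ r ih =>
    intro j hj s hs hInv
    obtain ⟨t, s', hexec, htime, hs'⟩ := hstep j (by omega) s hs hInv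
    obtain ⟨t', s'', hexec', htime', hs''⟩ :=
      ih (j + 1) (by omega) s' (hs.trans hexec.agree) hs'
    refine ⟨t + t' + 1, s'', .loop_true ((hb j (by omega) s hs hInv).2 (by omega)) hexec hexec',
      ?_, hs''⟩
    rw [Nat.succ_mul]
    omega

theorem forLoop (Inv : ℕ → Store → Prop) (hN : s₀.nat N 0 0 = m) (hm : m ≤ B) (h0 : Inv 0 s₀)
    (hstep : ∀ j < m, ∀ s, Agree (forLoop c N p) s₀ s → s.nat c 0 0 = j → Inv j s →
      Runs B p s (Inv (j + 1)))
    (hp : (p.keepsNat c && p.keepsNat N && N != c) = true := by rfl)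
    (hInv : ∀ j s x, Inv j s → Inv j (s.setNat c 0 0 x) := by exact fun _ _ _ h => h) :
    Runs B (forLoop c N p) s₀ (Inv m) := by
  simp only [Bool.and_eq_true, bne_iff_ne] at hp
  obtain ⟨⟨hc, hpN⟩, hNc⟩ := hp
  have hkeep : (Prog.seq p (increment c)).keepsNat N = true := by
    simp [Prog.keepsNat, hpN, hNc.symm]
  have hfor : ∀ {s s'}, Agree (KHop.assign c (.lit 0)) s₀ s →
      Agree (.seq p (increment c)) s s' → Agree (KHop.forLoop c N p) s₀ s' :=
    fun h h' => h.seq_left.trans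
      ((h'.mono (fun _ => id) fun _ => id : Agree (.loop _ _) _ _).seq_right)
  have hset : ∀ {s e z j}, e.eval s = z → Inv j s →
      Runs B (KHop.assign c e) s fun s' => s'.nat c 0 0 = z ∧ Inv j s' := fun {s e z j} he h =>
    ⟨1, _, .setNat c _ _ e s, le_rfl, by simp [Store.setNat, NExpr.eval, he], hInv _ _ _ h⟩
  refine (hset rfl h0).seq fun s hs ⟨hsc, hs0⟩ => ?_
  refine (loop (m := m) (fun j s => s.nat c 0 0 = j ∧ Inv j s) hm ⟨hsc, hs0⟩ ?_ ?_).mono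
    fun _ _ h => h.2
  · rintro j - s' hs' ⟨hj, -⟩
    simp only [BExpr.Holds, NExpr.eval, hj, hs'.nat hkeep 0 0, hs.nat (bne_iff_ne.2 hNc.symm), hN]
  · rintro j hj s' hs' ⟨hcj, hInvj⟩
    refine (hstep j hj s' (hfor hs hs') hcj hInvj).seq fun s'' hs'' h => hset ?_ h
    simp only [NExpr.eval, hs''.nat hc, hcj]

end Runs

/-! ### Sums and minima -/

/-- A test that always holds. -/
abbrev always : BExpr := .nlt (.lit 0) (.lit 1)

/-- Disjunction of tests. -/
abbrev disj (b c : BExpr) : BExpr := .neg (.conj (.neg b) (.neg c))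

/-- Equality of natural numbers, as a test. -/
abbrev natEq (e f : NExpr) : BExpr := .conj (.neg (.nlt e f)) (.neg (.nlt f e))

/-- Equality of rational numbers, as a test. -/
abbrev ratEq (e f : RExpr) : BExpr := .conj (.neg (.rlt e f)) (.neg (.rlt f e))

theorem holds_always (s : Store) : always.Holds s :=
  Nat.zero_lt_one

theorem holds_disj {b c : BExpr} {s : Store} : (disj b c).Holds s ↔ b.Holds s ∨ c.Holds s :=
  or_iff_not_and_not.symm

theorem holds_natEq {e f : NExpr} {s : Store} : (natEq e f).Holds s ↔ e.eval s = f.eval s := by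
  simp only [BExpr.Holds, not_lt, le_antisymm_iff, and_comm]

theorem holds_ratEq {e f : RExpr} {s : Store} : (ratEq e f).Holds s ↔ e.eval s = f.eval s := by
  simp only [BExpr.Holds, not_lt, le_antisymm_iff, and_comm]

/-- The assignment to `a` of the sum of `e` over those values `0, …, N - 1` of the counter `c` for
which `b` holds. -/
def accumulate (a c N : ℕ) (b : BExpr) (e : NExpr) : Prog :=
  .seq (assign a (.lit 0)) (forLoop c N (.ite b (assign a (.add (var a) e)) .skip))

/-- The assignment to `a` of the sum of the rational numbers `e` over those values `0, …, N - 1` of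
the counter `c` for which `b` holds. -/
def accumulateRat (a c N : ℕ) (b : BExpr) (e : RExpr) : Prog :=
  .seq (assignRat a (.lit 0)) (forLoop c N (.ite b (assignRat a (.add (ratVar a) e)) .skip))

/-- The assignment to `arg` of a value of the counter `c` that minimizes `e`, as computed by `p`,
among `start` and those of the values `0, …, N - 1` for which `b` holds. The minimum is assigned to
`val`. -/
def minimize (arg val c N : ℕ) (start : NExpr) (p : Prog) (b : BExpr) (e : RExpr) : Prog :=
  .seq (assign c start) (.seq p (.seq (.seq (assignRat val e) (assign arg (var c)))
    (forLoop c N (.seq p (.ite (.conj b (.rlt e (ratVar val)))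
      (.seq (assignRat val e) (assign arg (var c))) .skip)))))

namespace Runs

variable {B c N m : ℕ} {p : Prog} {s₀ : Store}

theorem forLoop_sum {R : Type*} [AddCommMonoid R] (val : Store → R) (f : Fin m → R)
    (hN : s₀.nat N 0 0 = m) (hm : m ≤ B) (h0 : val s₀ = 0)
    (hstep : ∀ (j : Fin m) s, Agree (KHop.forLoop c N p) s₀ s → s.nat c 0 0 = j →
      Runs B p s fun s' => val s' = val s + f j)
    (hp : (p.keepsNat c && p.keepsNat N && N != c) = true)
    (hval : ∀ s x, val (s.setNat c 0 0 x) = val s) :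
    Runs B (KHop.forLoop c N p) s₀ fun s => val s = ∑ j, f j := by
  rw [Finset.sum_fin_eq_sum_range]
  refine forLoop (fun j s => val s = ∑ i ∈ Finset.range j, if h : i < m then f ⟨i, h⟩ else 0)
    hN hm h0 (fun j hj s hs hc hInv => ?_) hp fun j s x h => (hval s x).trans h
  refine (hstep ⟨j, hj⟩ s hs hc).mono fun s' _ h => ?_
  rw [h, hInv, Finset.sum_range_succ, dif_pos hj]

theorem accumulate {a : ℕ} {b : BExpr} {e : NExpr} (f : Fin m → ℕ) (hN : s₀.nat N 0 0 = m)
    (hm : m ≤ B)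
    (hf : ∀ (j : Fin m) s, Agree (KHop.accumulate a c N b e) s₀ s → s.nat c 0 0 = j →
      (b.Holds s → e.eval s = f j) ∧ (¬ b.Holds s → f j = 0))
    (hac : (a != c) = true := by rfl) (haN : (a != N) = true := by rfl)
    (hNc : (N != c) = true := by rfl) :
    Runs B (KHop.accumulate a c N b e) s₀ fun s => s.nat a 0 0 = ∑ j, f j := by
  have hca : c ≠ a := (bne_iff_ne.1 hac).symm
  refine (assign rfl).seq fun s hs h0 => ?_
  refine forLoop_sum (fun s => s.nat a 0 0) f ((hs.nat haN 0 0).trans hN) hm h0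
    (fun j s' hs' hc => ?_) (by simp [Prog.keepsNat, hac, haN, hNc]) 
    fun s x => if_neg (hca ·.1.symm)
  obtain ⟨htrue, hfalse⟩ := hf j s' (hs.seq_left.trans hs'.seq_right) hc
  refine ite (fun hb => assign ?_) fun hb => skip ?_
  · simp only [NExpr.eval, htrue hb]
  · rw [hfalse hb, add_zero]

theorem accumulateRat {a : ℕ} {b : BExpr} {e : RExpr} (f : Fin m → ℚ) (hN : s₀.nat N 0 0 = m)
    (hm : m ≤ B)
    (hf : ∀ (j : Fin m) s, Agree (KHop.accumulateRat a c N b e) s₀ s → s.nat c 0 0 = j →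
      (b.Holds s → e.eval s = f j) ∧ (¬ b.Holds s → f j = 0))
    (hNc : (N != c) = true := by rfl) :
    Runs B (KHop.accumulateRat a c N b e) s₀ fun s => s.rat a 0 0 = ∑ j, f j := by
  refine (assignRat rfl).seq fun s hs h0 => ?_
  refine forLoop_sum (fun s => s.rat a 0 0) f ((hs.nat rfl 0 0).trans hN) hm h0
    (fun j s' hs' hc => ?_) (by simp [Prog.keepsNat, hNc]) fun s x => rfl
  obtain ⟨htrue, hfalse⟩ := hf j s' (hs.seq_left.trans hs'.seq_right) hc
  refine ite (fun hb => assignRat ?_) fun hb => skip ?_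
  · simp only [RExpr.eval, NExpr.eval, htrue hb]
  · rw [hfalse hb, add_zero]

theorem minimize {arg val x : ℕ} {start : NExpr} {b : BExpr} {e : RExpr} (P : ℕ → Prop) (f : ℕ → ℚ)
    (hN : s₀.nat N 0 0 = m) (hm : m ≤ B) (hstart : start.eval s₀ = x)
    (hstep : ∀ j, j = x ∨ j < m → ∀ s, Agree (KHop.minimize arg val c N start p b e) s₀ s →
      s.nat c 0 0 = j → Runs B p s fun s' => (b.Holds s' ↔ P j) ∧ e.eval s' = f j)
    (hp : (p.keepsNat c && p.keepsNat N && p.keepsNat arg && p.keepsRat val && arg != c &&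
      arg != N && N != c) = true := by rfl) :
    Runs B (KHop.minimize arg val c N start p b e) s₀ fun s =>
      (s.nat arg 0 0 = x ∨ s.nat arg 0 0 < m ∧ P (s.nat arg 0 0)) ∧
      s.rat val 0 0 = f (s.nat arg 0 0) ∧ ∀ j < m, P j → s.rat val 0 0 ≤ f j := by
  simp only [Bool.and_eq_true] at hp
  obtain ⟨⟨⟨⟨⟨⟨hpc, hpN⟩, hparg⟩, hpval⟩, hargc⟩, hargN⟩, hNc⟩ := hp
  have hcN := bne_iff_ne.2 (bne_iff_ne.1 hNc).symm
  have hupdate : ∀ {s y z}, s.nat c 0 0 = y → e.eval s = z →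
      Runs B (.seq (KHop.assignRat val e) (KHop.assign arg (var c))) s fun s' =>
        s'.nat arg 0 0 = y ∧ s'.rat val 0 0 = z := fun hy hz =>
    (assignRat hz).seq fun s' hs' hval => (assign (e := var c) ((hs'.nat rfl 0 0).trans hy)).mono
      fun s'' hs'' harg => ⟨harg, (hs''.rat rfl 0 0).trans hval⟩
  refine (assign hstart).seq fun s₁ h₁ hc₁ => ?_
  refine (hstep x (.inl rfl) s₁ h₁.seq_left hc₁).seq fun s₂ h₂ ⟨_, he₂⟩ => ?_
  refine (hupdate ((h₂.nat hpc 0 0).trans hc₁) he₂).seq fun s₃ h₃ ⟨harg₃, hval₃⟩ => ?_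
  refine forLoop (fun j s => (s.nat arg 0 0 = x ∨ s.nat arg 0 0 < m ∧ P (s.nat arg 0 0)) ∧
      s.rat val 0 0 = f (s.nat arg 0 0) ∧ ∀ i < j, P i → s.rat val 0 0 ≤ f i) ?_ hm
    ⟨.inl harg₃, by rw [hval₃, harg₃], fun i hi => absurd hi i.not_lt_zero⟩
    (fun j hj s hs hc ⟨hmem, hval, hle⟩ => ?_)
    (by simp [Prog.keepsNat, hpc, hpN, hargc, hargN, hNc])
    fun j s y h => by simpa [Store.setNat, bne_iff_ne.1 hargc] using h
  · rw [h₃.nat (by simp [Prog.keepsNat, hargN]), h₂.nat hpN, h₁.nat hcN, hN]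
  have hagree : Agree (KHop.minimize arg val c N start p b e) s₀ s :=
    h₁.seq_left.trans (h₂.seq_left.trans (h₃.seq_left.trans hs.seq_right).seq_right).seq_right
  refine (hstep j (.inr hj) s hagree hc).seq fun s' hs' ⟨hb, he⟩ => ?_
  simp only [← hs'.nat hparg 0 0, ← hs'.rat hpval 0 0] at hmem hval hle
  refine ite (fun hlt => ?_) fun hnlt => skip ⟨hmem, hval, ?_⟩
  · obtain ⟨hbs, hlt⟩ := hlt
    have hlt : f j < s'.rat val 0 0 := he ▸ hlt
    refine (hupdate ((hs'.nat hpc 0 0).trans hc) he).mono fun s'' _ ⟨harg, hval'⟩ => ?_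
    rw [harg, hval']
    exact ⟨.inr ⟨hj, hb.1 hbs⟩, rfl, Nat.forall_lt_succ_right.2
      ⟨fun i hi hPi => hlt.le.trans (hle i hi hPi), fun _ => le_rfl⟩⟩
  · exact Nat.forall_lt_succ_right.2 ⟨hle, fun hPj => not_lt.1 fun hlt =>
      hnlt ⟨hb.2 hPj, he.trans_lt hlt⟩⟩

end Runs

/-! ### Preprocessing -/

namespace Arr

abbrev points : ℕ := 0
abbrev hops : ℕ := 1
abbrev root : ℕ := 2
abbrev terminals : ℕ := 3
abbrev outVerts : ℕ := 4
abbrev outAdj : ℕ := 5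
abbrev levels : ℕ := 6
abbrev numStates : ℕ := 7
abbrev digit : ℕ := 8
abbrev parent : ℕ := 9
abbrev order : ℕ := 10
abbrev best : ℕ := 11
abbrev chosen : ℕ := 12
abbrev link : ℕ := 13
abbrev v : ℕ := 14
abbrev u : ℕ := 15
abbrev x : ℕ := 16
abbrev y : ℕ := 17
abbrev i : ℕ := 18
abbrev j : ℕ := 19
abbrev label : ℕ := 20
abbrev arg : ℕ := 21
abbrev count : ℕ := 22
abbrev quo : ℕ := 23
abbrev rem : ℕ := 24

-- The arrays of rational numbers are numbered separately.
abbrev dist : ℕ := 0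
abbrev big : ℕ := 1
abbrev table : ℕ := 2
abbrev msg : ℕ := 3
abbrev cost : ℕ := 4
abbrev sum : ℕ := 5
abbrev min : ℕ := 6

end Arr

/-- The assignment of `min k n + 1` to the variable `levels`. -/
def levelsProg : Prog :=
  .ite (.nlt (var Arr.hops) (var Arr.points)) (assign Arr.levels (.add (var Arr.hops) (.lit 1)))
    (assign Arr.levels (.add (var Arr.points) (.lit 1)))

/-- The assignment of `n ^ levels` to the variable `numStates`. -/
def numStatesProg : Prog :=
  .seq (assign Arr.numStates (.lit 1)) (forLoop Arr.i Arr.levels (.seq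
    (accumulate Arr.count Arr.v Arr.points always (var Arr.numStates))
    (assign Arr.numStates (var Arr.count))))

/-- Incrementing the number `n * quo + rem`, where `rem < n`. -/
def stepDigitsProg : Prog :=
  .ite (.nlt (.add (var Arr.rem) (.lit 1)) (var Arr.points)) (increment Arr.rem)
    (.seq (increment Arr.quo) (assign Arr.rem (.lit 0)))

/-- The computation of the digits of `x` from the last one and those of `x / n`. -/
def digitRowProg : Prog :=
  forLoop Arr.i Arr.levels (.setNat Arr.digit (var Arr.x) (.add (var Arr.i) (.lit 1))
    (.get Arr.digit (var Arr.quo) (var Arr.i)))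

/-- The computation of the digits of all states. -/
def digitsProg : Prog :=
  .seq (.seq (assign Arr.quo (.lit 0)) (assign Arr.rem (.lit 0)))
    (forLoop Arr.x Arr.numStates (.seq (.setNat Arr.digit (var Arr.x) (.lit 0) (var Arr.rem))
      (.seq digitRowProg stepDigitsProg)))

/-- The distance between the points given by two expressions. -/
abbrev distExpr (u v : NExpr) : RExpr := .get Arr.dist u v

/-- The assignment of `I.big` to the variable `big`. -/
def bigProg : Prog :=
  .seq (accumulateRat Arr.sum Arr.v Arr.points always (distExpr (var Arr.root) (var Arr.v)))
    (assignRat Arr.big (.add (.lit 1) (ratVar Arr.sum)))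

/-- The test whether the point `u ≠ v` lies between the root and `v`. -/
def betweenTest : BExpr :=
  .conj (.neg (natEq (var Arr.u) (var Arr.v))) (ratEq (distExpr (var Arr.root) (var Arr.v))
    (.add (distExpr (var Arr.root) (var Arr.u)) (distExpr (var Arr.u) (var Arr.v))))

/-- The computation of the parents of all points. -/
def parentsProg : Prog :=
  forLoop Arr.v Arr.points (.seq
    (minimize Arr.arg Arr.min Arr.u Arr.points (var Arr.root) .skip betweenTest
      (distExpr (var Arr.u) (var Arr.v)))
    (.setNat Arr.parent (.lit 0) (var Arr.v) (var Arr.arg)))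

/-- The test whether `u` is to be eliminated before `v`. -/
def beforeTest : BExpr :=
  disj (.rlt (distExpr (var Arr.root) (var Arr.v)) (distExpr (var Arr.root) (var Arr.u)))
    (.conj (ratEq (distExpr (var Arr.root) (var Arr.u)) (distExpr (var Arr.root) (var Arr.v)))
      (.nlt (var Arr.u) (var Arr.v)))

/-- Listing the points in the order of elimination. -/
def orderProg : Prog :=
  forLoop Arr.v Arr.points (.seq (accumulate Arr.count Arr.u Arr.points beforeTest (.lit 1))
    (.setNat Arr.order (.lit 0) (var Arr.count) (var Arr.v)))

/-- The computation of everything that is needed for the elimination. -/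
def preprocessProg : Prog :=
  .seq levelsProg (.seq numStatesProg (.seq digitsProg (.seq bigProg (.seq parentsProg orderProg))))

namespace Problem

/-- The memory `s` contains the input `I`. -/
structure IsLoaded (I : Problem) (s : Store) : Prop where
  points : s.nat Arr.points 0 0 = I.n
  hops : s.nat Arr.hops 0 0 = I.k
  root : s.nat Arr.root 0 0 = I.root
  terminals : ∀ v : Fin I.n, 0 < s.nat Arr.terminals v 0 ↔ v ∈ I.terminals
  dist : ∀ u v : Fin I.n, s.rat Arr.dist u v = I.dist u v

/-- The memory `s` contains the input `I` and the results of preprocessing, with `par` as the parent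
function. -/
structure IsPrepared (I : Problem) (par : Fin I.n → Fin I.n) (s : Store) : Prop
    extends I.IsLoaded s where
  levels : s.nat Arr.levels 0 0 = I.levels
  numStates : s.nat Arr.numStates 0 0 = I.numStates
  digit : ∀ x < I.numStates, ∀ i < I.levels, s.nat Arr.digit x i = I.state x i
  big : s.rat Arr.big 0 0 = I.big
  parent : ∀ v : Fin I.n, s.nat Arr.parent 0 v = par v
  order : ∀ v : Fin I.n, s.nat Arr.order 0 (I.rank v) = v

theorem isLoaded_input (I : Problem) : I.IsLoaded I.input where
  points := rfl
  hops := rfl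
  root := rfl
  terminals v := by
    by_cases h : v ∈ I.terminals <;> simp [input, h, ← Fin.ext_iff]
  dist u v := dif_pos ⟨rfl, u.2, v.2⟩

variable {I : Problem} {par : Fin I.n → Fin I.n} {p : Prog} {s s' : Store} {B : ℕ}

theorem IsLoaded.of_agree (h : I.IsLoaded s) (hs : Agree p s s')
    (hp : (p.keepsNat Arr.points && p.keepsNat Arr.hops && p.keepsNat Arr.root &&
      p.keepsNat Arr.terminals && p.keepsRat Arr.dist) = true := by rfl) : I.IsLoaded s' := by
  simp only [Bool.and_eq_true] at hp
  obtain ⟨⟨⟨⟨hpoints, hhops⟩, hroot⟩, hterminals⟩, hdist⟩ := hp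
  exact ⟨(hs.nat hpoints _ _).trans h.points, (hs.nat hhops _ _).trans h.hops,
    (hs.nat hroot _ _).trans h.root, fun v => (hs.nat hterminals _ _).symm ▸ h.terminals v,
    fun u v => (hs.rat hdist _ _).trans (h.dist u v)⟩

theorem IsPrepared.of_agree (h : I.IsPrepared par s) (hs : Agree p s s')
    (hload : (p.keepsNat Arr.points && p.keepsNat Arr.hops && p.keepsNat Arr.root &&
      p.keepsNat Arr.terminals && p.keepsRat Arr.dist) = true := by rfl)
    (hp : (p.keepsNat Arr.levels && p.keepsNat Arr.numStates && p.keepsNat Arr.digit &&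
      p.keepsRat Arr.big && p.keepsNat Arr.parent && p.keepsNat Arr.order) = true := by rfl) :
    I.IsPrepared par s' := by
  simp only [Bool.and_eq_true] at hp
  obtain ⟨⟨⟨⟨⟨hlevels, hnumStates⟩, hdigit⟩, hbig⟩, hparent⟩, horder⟩ := hp
  exact ⟨h.toIsLoaded.of_agree hs hload, (hs.nat hlevels _ _).trans h.levels,
    (hs.nat hnumStates _ _).trans h.numStates,
    fun x hx i hi => (hs.nat hdigit _ _).trans (h.digit x hx i hi),
    (hs.rat hbig _ _).trans h.big, fun v => (hs.nat hparent _ _).trans (h.parent v),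
    fun v => (hs.nat horder _ _).trans (h.order v)⟩

theorem runs_levelsProg (h : I.IsLoaded s) :
    Runs B levelsProg s fun s' => s'.nat Arr.levels 0 0 = I.levels := by
  refine .ite (fun hlt => .assign ?_) fun hlt => .assign ?_ <;>
    simp only [BExpr.Holds, NExpr.eval, h.hops, h.points] at hlt ⊢ <;> rw [levels] <;> omega

theorem runs_numStatesProg (hB : I.n + I.levels ≤ B) (h : I.IsLoaded s)
    (hl : s.nat Arr.levels 0 0 = I.levels) :
    Runs B numStatesProg s fun s' => s'.nat Arr.numStates 0 0 = I.numStates := by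
  refine .seq (Runs.assign rfl) fun s₁ h₁ h0 => ?_
  refine Runs.forLoop (fun i s => s.nat Arr.numStates 0 0 = I.n ^ i) ((h₁.nat rfl 0 0).trans hl)
    (by omega) h0 fun i _ s₂ h₂ _ hInv => ?_
  have h₂' := (h.of_agree h₁).of_agree h₂
  refine .seq (Runs.accumulate (fun _ : Fin I.n => I.n ^ i) h₂'.points (by omega)
    fun _ s₃ h₃ _ => ⟨fun _ => by exact (h₃.nat rfl 0 0).trans hInv, fun hb =>
      absurd (holds_always s₃) hb⟩) fun s₃ _ hsum => Runs.assign ?_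
  rw [NExpr.eval, NExpr.eval, hsum, Finset.sum_const, Finset.card_univ, Fintype.card_fin,
    smul_eq_mul, pow_succ']

theorem runs_stepDigitsProg (h : I.IsLoaded s) {x : ℕ} (hq : s.nat Arr.quo 0 0 = x / I.n)
    (hr : s.nat Arr.rem 0 0 = x % I.n) : Runs B stepDigitsProg s fun s' =>
      s'.nat Arr.quo 0 0 = (x + 1) / I.n ∧ s'.nat Arr.rem 0 0 = (x + 1) % I.n := by
  have hn : 0 < I.n := Fin.pos I.root
  have hx := Nat.mod_add_div x I.n
  have hlt := Nat.mod_lt x hn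
  refine .ite (fun hb => ?_) fun hb => ?_ <;>
    simp only [BExpr.Holds, NExpr.eval, hr, h.points] at hb
  · refine .mono (Runs.assign (z := x % I.n + 1) (by simp only [NExpr.eval, hr]))
      fun s₁ h₁ hrem => ?_
    rw [h₁.nat rfl, hq, hrem, eq_comm, @eq_comm _ (_ + 1), Nat.div_mod_unique hn]
    omega
  · refine .seq (Runs.assign (z := x / I.n + 1) (by simp only [NExpr.eval, hq])) fun s₁ _ hquo =>
      .mono (Runs.assign (z := 0) rfl) fun s₂ h₂ hrem => ?_
    rw [h₂.nat rfl, hquo, hrem, eq_comm, @eq_comm _ 0, Nat.div_mod_unique hn, mul_add]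
    omega

theorem state_zero (I : Problem) (x : ℕ) : (I.state x 0 : ℕ) = x % I.n := by
  simp only [state, pow_zero, Nat.div_one]

theorem state_succ (I : Problem) (x i : ℕ) : I.state x (i + 1) = I.state (x / I.n) i := by
  simp only [state, pow_succ', Nat.div_div_eq_div_mul]

theorem runs_digitRowProg {x : ℕ} (hB : I.levels ≤ B) (hl : s.nat Arr.levels 0 0 = I.levels)
    (hx : s.nat Arr.x 0 0 = x) (hquo : s.nat Arr.quo 0 0 = x / I.n)
    (hzero : s.nat Arr.digit x 0 = I.state x 0)
    (hprev : ∀ x' < x, ∀ i ≤ I.levels, s.nat Arr.digit x' i = I.state x' i) :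
    Runs B digitRowProg s fun s' =>
      ∀ x' ≤ x, ∀ i ≤ I.levels, s'.nat Arr.digit x' i = I.state x' i := by
  refine .mono (Runs.forLoop (fun i s => (∀ i' ≤ i, s.nat Arr.digit x i' = I.state x i') ∧
      ∀ x' < x, ∀ i ≤ I.levels, s.nat Arr.digit x' i = I.state x' i)
    hl hB ⟨fun i hi => ?_, hprev⟩ fun i hi s₁ h₁ his ⟨hrow, hprev⟩ => ?_)
    fun s' _ ⟨hrow, hprev⟩ x' hx' => ?_
  · rw [Nat.le_zero.1 hi, hzero]
  · have hdigit : s₁.nat Arr.digit (x / I.n) i = I.state (x / I.n) i := by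
      rcases (Nat.div_le_self x I.n).lt_or_eq with hlt | heq
      · exact hprev _ hlt _ hi.le
      · rw [heq, hrow i le_rfl]
    refine .mono (Runs.setNat (x := x) (y := i + 1) (z := I.state x (i + 1))
      ((h₁.nat rfl 0 0).trans hx) ?_ ?_)
      fun s₂ _ ⟨hset, hkeep⟩ => ⟨fun i' hi' => ?_, fun x' hx' i' hi' => ?_⟩
    · simp only [NExpr.eval, his]
    · simp only [NExpr.eval, his, h₁.nat (a := Arr.quo) rfl, hquo, hdigit, I.state_succ]
    · rcases Nat.le_succ_iff.1 hi' with hle | rfl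
      · rw [hkeep _ _ (.inr (by omega)), hrow _ hle]
      · exact hset
    · rw [hkeep _ _ (.inl hx'.ne), hprev x' hx' i' hi']
  · rcases hx'.lt_or_eq with hlt | rfl
    exacts [hprev x' hlt, hrow]

theorem runs_digitsProg (hB : I.levels + I.numStates ≤ B) (h : I.IsLoaded s)
    (hl : s.nat Arr.levels 0 0 = I.levels) (hS : s.nat Arr.numStates 0 0 = I.numStates) :
    Runs B digitsProg s fun s' =>
      ∀ x < I.numStates, ∀ i < I.levels, s'.nat Arr.digit x i = I.state x i := by
  have hstart : Runs B (.seq (assign Arr.quo (.lit 0)) (assign Arr.rem (.lit 0))) s fun s' =>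
      s'.nat Arr.quo 0 0 = 0 ∧ s'.nat Arr.rem 0 0 = 0 :=
    .seq (.assign rfl) fun s₁ _ hquo =>
      .mono (.assign rfl) fun s₂ h₂ hrem => ⟨(h₂.nat rfl 0 0).trans hquo, hrem⟩
  refine .seq hstart fun s₁ h₁ ⟨hquo, hrem⟩ => ?_
  refine .mono (Runs.forLoop (fun x s => s.nat Arr.quo 0 0 = x / I.n ∧ s.nat Arr.rem 0 0 = x % I.n ∧
      ∀ x' < x, ∀ i ≤ I.levels, s.nat Arr.digit x' i = I.state x' i)
    ((h₁.nat rfl 0 0).trans hS) (by omega) ⟨by simpa using hquo, by simpa using hrem,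
      fun x hx => absurd hx x.not_lt_zero⟩ fun x _ s₂ h₂ hxs ⟨hquo, hrem, hdigit⟩ => ?_)
    fun s' _ ⟨_, _, hdigit⟩ x hx i hi => hdigit x hx i hi.le
  refine .seq (Runs.setNat (y := 0) hxs rfl hrem) fun s₃ h₃ ⟨hzero, hother⟩ => ?_
  have hload := ((h.of_agree h₁).of_agree h₂).of_agree h₃
  refine .seq (runs_digitRowProg (x := x) (by omega) ?_ ((h₃.nat rfl 0 0).trans hxs)
    ((h₃.nat rfl 0 0).trans hquo) (hzero.trans (I.state_zero x).symm) fun x' hx' i hi => ?_)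
    fun s₄ h₄ hdigit => ?_
  · rw [h₃.nat rfl, h₂.nat rfl, h₁.nat rfl, hl]
  · rw [hother _ _ (.inl hx'.ne), hdigit x' hx' i hi]
  · refine .mono (runs_stepDigitsProg (x := x) (hload.of_agree h₄) ?_ ?_)
      fun s₅ h₅ ⟨hquo, hrem⟩ => ⟨hquo, hrem, fun x' hx' i hi => ?_⟩
    · rw [h₄.nat rfl, h₃.nat rfl, hquo]
    · rw [h₄.nat rfl, h₃.nat rfl, hrem]
    · rw [h₅.nat rfl, hdigit x' (Nat.lt_succ_iff.1 hx') i hi]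

theorem runs_bigProg (hB : I.n ≤ B) (h : I.IsLoaded s) :
    Runs B bigProg s fun s' => s'.rat Arr.big 0 0 = I.big := by
  refine .seq (Runs.accumulateRat (I.dist I.root) h.points hB fun v s₁ h₁ hv =>
    ⟨fun _ => ?_, fun hb => absurd (holds_always s₁) hb⟩) fun s₁ _ hsum => Runs.assignRat ?_
  · have h₁ := h.of_agree h₁
    simp only [RExpr.eval, NExpr.eval, hv, h₁.root, h₁.dist]
  · rw [RExpr.eval, RExpr.eval, RExpr.eval, NExpr.eval, hsum, big]

theorem holds_betweenTest (h : I.IsLoaded s) {u v : Fin I.n} (hu : s.nat Arr.u 0 0 = u)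
    (hv : s.nat Arr.v 0 0 = v) : betweenTest.Holds s ↔
      u ≠ v ∧ I.dist I.root v = I.dist I.root u + I.dist u v := by
  rw [betweenTest, BExpr.Holds, BExpr.Holds, holds_natEq, holds_ratEq]
  simp only [RExpr.eval, NExpr.eval, hu, hv, h.root, h.dist, Fin.val_inj, ne_eq]

theorem runs_minimize_parent (hB : I.n ≤ B) (h : I.IsLoaded s) {v : Fin I.n}
    (hv : s.nat Arr.v 0 0 = v) :
    Runs B (minimize Arr.arg Arr.min Arr.u Arr.points (var Arr.root) .skip betweenTest
      (distExpr (var Arr.u) (var Arr.v))) s fun s' => ∃ p : Fin I.n, s'.nat Arr.arg 0 0 = p ∧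
        (v ≠ I.root → IsParent v p) := by
  refine .mono (Runs.minimize
    (fun j => ∃ u : Fin I.n, j = u ∧ u ≠ v ∧ I.dist I.root v = I.dist I.root u + I.dist u v)
    (fun j => if hj : j < I.n then I.dist ⟨j, hj⟩ v else 0) h.points hB h.root
    fun j hj s₁ h₁ hjs => ?_) fun s' _ ⟨hmem, hval, hmin⟩ => ?_
  · replace hj : j < I.n := hj.elim (fun h => h ▸ I.root.2) id
    have h₁' := h.of_agree h₁
    have hvs := (h₁.nat rfl 0 0).trans hv
    refine .skip ⟨(holds_betweenTest (u := ⟨j, hj⟩) h₁' hjs hvs).trans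
      ⟨fun hu => ⟨_, rfl, hu⟩, ?_⟩, ?_⟩
    · rintro ⟨u, rfl, hu⟩
      exact hu
    · simp only [RExpr.eval, NExpr.eval, hjs, hvs, dif_pos hj]
      exact h₁'.dist ⟨j, hj⟩ v
  · obtain ⟨p, hp, hp'⟩ : ∃ p : Fin I.n, s'.nat Arr.arg 0 0 = p ∧
        (p = I.root ∨ p ≠ v ∧ I.dist I.root v = I.dist I.root p + I.dist p v) := by
      obtain hroot | ⟨-, p, hp, hp'⟩ := hmem
      exacts [⟨I.root, hroot, .inl rfl⟩, ⟨p, hp, .inr hp'⟩]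
    refine ⟨p, hp, fun hv => ?_⟩
    have hbetween : p ≠ v ∧ I.dist I.root v = I.dist I.root p + I.dist p v := by
      rcases hp' with rfl | hp'
      exacts [⟨hv.symm, by rw [I.dist_self, zero_add]⟩, hp']
    refine ⟨hbetween.1, hbetween.2, fun u hu hd => ?_⟩
    simpa only [hval, hp, p.2, u.2, dif_pos, Fin.eta] using hmin u u.2 ⟨u, rfl, hu, hd⟩

theorem runs_parentsProg (hB : I.n ≤ B) (h : I.IsLoaded s) : Runs B parentsProg s fun s' =>
    ∃ par, I.IsParentMap par ∧ ∀ v : Fin I.n, s'.nat Arr.parent 0 v = par v := by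
  refine .mono (Runs.forLoop (fun j s => ∀ v : Fin I.n, v < j → ∃ p : Fin I.n,
      s.nat Arr.parent 0 v = p ∧ (v ≠ I.root → IsParent v p))
    h.points hB (fun v hv => absurd hv (Nat.not_lt_zero _))
    fun j hj s₁ h₁ hjs hInv => ?_) fun s' _ hs' => ?_
  · refine .seq (runs_minimize_parent (v := ⟨j, hj⟩) hB (h.of_agree h₁) hjs)
      fun s₂ h₂ ⟨p, harg, hp⟩ => ?_
    refine .mono (Runs.setNat rfl ((h₂.nat rfl 0 0).trans hjs) harg)
      fun s₃ _ ⟨hset, hkeep⟩ v hv => ?_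
    rcases Nat.lt_succ_iff_lt_or_eq.1 hv with hlt | heq
    · obtain ⟨q, hq, hq'⟩ := hInv v hlt
      exact ⟨q, by rw [hkeep _ _ (.inr hlt.ne), h₂.nat rfl, hq], hq'⟩
    · obtain rfl : v = ⟨j, hj⟩ := Fin.ext heq
      exact ⟨p, hset, hp⟩
  · choose par hpar hparent using fun v => hs' v v.2
    exact ⟨par, hparent, hpar⟩

theorem holds_beforeTest (h : I.IsLoaded s) {u v : Fin I.n} (hu : s.nat Arr.u 0 0 = u)
    (hv : s.nat Arr.v 0 0 = v) : beforeTest.Holds s ↔ I.key u < I.key v := by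
  rw [beforeTest, holds_disj, BExpr.Holds, BExpr.Holds, holds_ratEq, key_lt_key_iff]
  simp only [BExpr.Holds, RExpr.eval, NExpr.eval, hu, hv, h.root, h.dist, Fin.lt_def]

theorem runs_orderProg (hB : I.n ≤ B) (h : I.IsLoaded s) :
    Runs B orderProg s fun s' => ∀ v : Fin I.n, s'.nat Arr.order 0 (I.rank v) = v := by
  refine .mono (Runs.forLoop (fun j s => ∀ v : Fin I.n, v < j → s.nat Arr.order 0 (I.rank v) = v)
    h.points hB (fun v hv => absurd hv (Nat.not_lt_zero _))
    fun j hj s₁ h₁ hjs hInv => ?_) fun s' _ hs' v => hs' v v.2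
  have hcount : Runs B (accumulate Arr.count Arr.u Arr.points beforeTest (.lit 1)) s₁ fun s' =>
      s'.nat Arr.count 0 0 = I.rank ⟨j, hj⟩ := by
    rw [rank, Finset.card_filter]
    refine Runs.accumulate _ (h.of_agree h₁).points hB fun u s₂ h₂ hu => ?_
    have hb := holds_beforeTest (v := ⟨j, hj⟩) ((h.of_agree h₁).of_agree h₂) hu
      ((h₂.nat rfl 0 0).trans hjs)
    exact ⟨fun hlt => (if_pos (hb.1 hlt)).symm, fun hlt => if_neg (mt hb.2 hlt)⟩
  refine .seq hcount fun s₂ h₂ hrank => ?_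
  refine .mono (Runs.setNat rfl hrank ((h₂.nat rfl 0 0).trans hjs))
    fun s₃ _ ⟨hset, hkeep⟩ v hv => ?_
  rcases Nat.lt_succ_iff_lt_or_eq.1 hv with hlt | heq
  · have hne : v ≠ ⟨j, hj⟩ := fun h => hlt.ne (congrArg Fin.val h)
    rw [hkeep _ _ (.inr (I.rank_injective.ne hne)), h₂.nat rfl, hInv v hlt]
  · obtain rfl : v = ⟨j, hj⟩ := Fin.ext heq
    exact hset

theorem runs_preprocessProg (hB : I.n + I.levels + I.numStates ≤ B) (h : I.IsLoaded s) :
    Runs B preprocessProg s fun s' => ∃ par, I.IsParentMap par ∧ I.IsPrepared par s' := by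
  refine .seq (runs_levelsProg h) fun s₁ h₁ hlevels => ?_
  replace h₁ := h.of_agree h₁
  refine .seq (runs_numStatesProg (by omega) h₁ hlevels) fun s₂ h₂ hnumStates => ?_
  have hlevels₂ := (h₂.nat rfl 0 0).trans hlevels
  refine .seq (runs_digitsProg (by omega) (h₁.of_agree h₂) hlevels₂ hnumStates)
    fun s₃ h₃ hdigit => ?_
  have hs₃ := (h₁.of_agree h₂).of_agree h₃
  refine .seq (runs_bigProg (by omega) hs₃) fun s₄ h₄ hbig => ?_
  refine .seq (runs_parentsProg (by omega) (hs₃.of_agree h₄)) fun s₅ h₅ ⟨par, hpar, hparent⟩ => ?_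
  refine .mono (runs_orderProg (by omega) ((hs₃.of_agree h₄).of_agree h₅)) fun s₆ h₆ horder =>
    ⟨par, hpar, ((hs₃.of_agree h₄).of_agree h₅).of_agree h₆, ?_, ?_, fun x hx i hi => ?_, ?_,
      fun v => ?_, horder⟩
  · rw [h₆.nat rfl, h₅.nat rfl, h₄.nat rfl, h₃.nat rfl, hlevels₂]
  · rw [h₆.nat rfl, h₅.nat rfl, h₄.nat rfl, h₃.nat rfl, hnumStates]
  · rw [h₆.nat rfl, h₅.nat rfl, h₄.nat rfl, hdigit x hx i hi]
  · rw [h₆.rat rfl, h₅.rat rfl, hbig]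
  · rw [h₆.nat rfl, hparent]

end Problem

/-! ### Elimination of a point -/

/-- The component with the given index of the state with the given number. -/
abbrev stateExpr (x i : NExpr) : NExpr := .get Arr.digit x i

/-- The assignment of the label of `v` under the state `x` to the variable `label`. -/
def labelProg : Prog :=
  .seq (assign Arr.label (.lit 0)) (forLoop Arr.i Arr.levels (.ite
    (.conj (natEq (var Arr.label) (var Arr.i))
      (.neg (natEq (stateExpr (var Arr.x) (var Arr.i)) (var Arr.v))))
    (increment Arr.label) .skip))

/-- The assignment of the cost of `v` under the state `x` to the variable `cost`. -/
def vertexCostProg : Prog :=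
  .seq labelProg (.ite (.neg (natEq (stateExpr (var Arr.x) (.lit 0)) (var Arr.root)))
    (assignRat Arr.cost (ratVar Arr.big)) (.ite (.nlt (var Arr.label) (var Arr.levels))
      (assignRat Arr.cost (distExpr (var Arr.v)
        (stateExpr (var Arr.x) (.sub (var Arr.label) (.lit 1)))))
      (.ite (.nlt (.lit 0) (.get Arr.terminals (var Arr.v) (.lit 0)))
        (assignRat Arr.cost (ratVar Arr.big)) (assignRat Arr.cost (.lit 0)))))

/-- The parent of `v`. -/
abbrev parentExpr : NExpr := .get Arr.parent (.lit 0) (var Arr.v)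

/-- The test whether the states `y` of `v` and `x` of its parent are in conflict at depth `i`. -/
def conflictTest : BExpr :=
  .conj (.neg (natEq (stateExpr (var Arr.y) (var Arr.i)) (stateExpr (var Arr.x) (var Arr.i))))
    (.neg (.conj
      (.rlt (distExpr (var Arr.v) (stateExpr (var Arr.y) (var Arr.i)))
        (.add (distExpr (var Arr.v) parentExpr)
          (distExpr parentExpr (stateExpr (var Arr.y) (var Arr.i)))))
      (.rlt (distExpr parentExpr (stateExpr (var Arr.x) (var Arr.i)))
        (.add (distExpr parentExpr (var Arr.v))
          (distExpr (var Arr.v) (stateExpr (var Arr.x) (var Arr.i)))))))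

/-- The assignment of the penalty for the states `y` of `v` and `x` of its parent to the variable
`sum`. -/
def penaltyProg : Prog :=
  accumulateRat Arr.sum Arr.i Arr.levels (.conj (.neg (natEq (var Arr.v) (var Arr.root)))
    conflictTest) (ratVar Arr.big)

/-- The test whether `u` is a child of `v`. -/
def childTest : BExpr :=
  .conj (.neg (natEq (var Arr.u) (var Arr.root)))
    (natEq (.get Arr.parent (.lit 0) (var Arr.u)) (var Arr.v))

/-- The computation of the least costs of the subtree of `v`. -/
def tableProg : Prog :=
  forLoop Arr.x Arr.numStates (.seq vertexCostProg (.seq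
    (accumulateRat Arr.sum Arr.u Arr.points childTest (.get Arr.msg (var Arr.u) (var Arr.x)))
    (.setRat Arr.table (var Arr.v) (var Arr.x) (.add (ratVar Arr.cost) (ratVar Arr.sum)))))

/-- The choice of the best state of `v` for the state `x` of its parent. -/
def messageEntryProg : Prog :=
  .seq (minimize Arr.arg Arr.min Arr.y Arr.numStates (.lit 0) penaltyProg always
      (.add (.get Arr.table (var Arr.v) (var Arr.y)) (ratVar Arr.sum)))
    (.seq (.setNat Arr.best (var Arr.v) (var Arr.x) (var Arr.arg))
      (.setRat Arr.msg (var Arr.v) (var Arr.x) (ratVar Arr.min)))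

/-- The choice of the best state of `v` for each state of its parent. -/
def messageProg : Prog :=
  forLoop Arr.x Arr.numStates messageEntryProg

/-- The elimination of all points. -/
def eliminateProg : Prog :=
  forLoop Arr.j Arr.points (.seq (assign Arr.v (.get Arr.order (.lit 0) (var Arr.j)))
    (.seq tableProg messageProg))

namespace Problem

variable {I : Problem} {par : Fin I.n → Fin I.n} {s : Store} {B x y : ℕ} {v : Fin I.n}

theorem numStates_pos (I : Problem) : 0 < I.numStates :=
  pow_pos (Fin.pos I.root) _

theorem levels_pos (I : Problem) : 0 < I.levels :=
  Nat.succ_pos _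

theorem runs_labelProg (hB : I.levels ≤ B) (h : I.IsPrepared par s) (hv : s.nat Arr.v 0 0 = v)
    (hx : s.nat Arr.x 0 0 = x) (hxS : x < I.numStates) :
    Runs B labelProg s fun s' => s'.nat Arr.label 0 0 = label v (I.state x) := by
  refine .seq (Runs.assign rfl) fun s₁ h₁ h0 => ?_
  refine .mono (Runs.forLoop
    (fun i s => s.nat Arr.label 0 0 = Nat.min (label v (I.state x)) i)
    ((h₁.nat rfl 0 0).trans h.levels) hB (h0.trans (Nat.min_zero _).symm)
    fun i hi s₂ h₂ his hInv => ?_)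
    fun s' _ hs' => hs'.trans (min_eq_left (label_le_levels v _))
  have hdigit := ((h.of_agree h₁).of_agree h₂).digit x hxS i hi
  have hvs : s₂.nat Arr.v 0 0 = v := by rw [h₂.nat rfl, h₁.nat rfl, hv]
  have hxs : s₂.nat Arr.x 0 0 = x := by rw [h₂.nat rfl, h₁.nat rfl, hx]
  have htest : BExpr.Holds s₂ (.conj (natEq (var Arr.label) (var Arr.i))
      (.neg (natEq (stateExpr (var Arr.x) (var Arr.i)) (var Arr.v)))) ↔
        Nat.min (label v (I.state x)) i = i ∧ I.state x i ≠ v := by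
    rw [BExpr.Holds, BExpr.Holds, holds_natEq, holds_natEq]
    simp only [NExpr.eval, his, hInv, hxs, hvs, hdigit, Fin.val_inj, ne_eq]
  refine .ite (fun hb => .assign ?_) fun hb => .skip ?_ <;> rw [htest] at hb
  · obtain ⟨hmin, hne⟩ := hb
    have hlt : i ≠ label v (I.state x) := fun heq => hne (by
      conv_lhs => rw [heq]
      exact apply_label (heq ▸ hi))
    rw [NExpr.eval, NExpr.eval, NExpr.eval, NExpr.eval, hInv]
    have := min_eq_right_iff.1 hmin
    exact hmin.symm ▸ (min_eq_right (by omega)).symm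
  · rw [hInv]
    have hle : label v (I.state x) ≤ i := by
      by_contra! hlt
      exact hb ⟨min_eq_right hlt.le, fun heq => hlt.not_ge (label_le_of_eq heq)⟩
    exact (min_eq_left hle).trans (min_eq_left (by omega)).symm

theorem runs_vertexCostProg (hB : I.levels ≤ B) (h : I.IsPrepared par s)
    (hv : s.nat Arr.v 0 0 = v) (hx : s.nat Arr.x 0 0 = x) (hxS : x < I.numStates) :
    Runs B vertexCostProg s fun s' => s'.rat Arr.cost 0 0 = vertexCost v (I.state x) := by
  refine .seq (runs_labelProg hB h hv hx hxS) fun s₁ h₁ hlabel => ?_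
  replace h := h.of_agree h₁
  replace hv := (h₁.nat rfl 0 0).trans hv
  replace hx := (h₁.nat rfl 0 0).trans hx
  have hroot : BExpr.Holds s₁ (.neg (natEq (stateExpr (var Arr.x) (.lit 0)) (var Arr.root))) ↔
      I.state x 0 ≠ I.root := by
    rw [BExpr.Holds, holds_natEq]
    simp only [NExpr.eval, hx, h.digit x hxS 0 I.levels_pos, h.root, Fin.val_inj, ne_eq]
  have hlevels : BExpr.Holds s₁ (.nlt (var Arr.label) (var Arr.levels)) ↔
      label v (I.state x) < I.levels := by
    simp only [BExpr.Holds, NExpr.eval, hlabel, h.levels]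
  have hterm : BExpr.Holds s₁ (.nlt (.lit 0) (.get Arr.terminals (var Arr.v) (.lit 0))) ↔
      v ∈ I.terminals := by
    simp only [BExpr.Holds, NExpr.eval, hv, h.terminals]
  classical
  rw [vertexCost, ← h.big]
  simp only [← hroot, ← hlevels, ← hterm]
  refine .ite (fun hb => .assignRat (if_pos hb).symm) fun hb => .ite (fun hlt => .assignRat ?_)
    fun hlt => .ite (fun hb' => .assignRat ?_) fun hb' => .assignRat ?_
  · have hpred := (Nat.sub_le _ 1).trans_lt (hlevels.1 hlt)
    rw [if_neg hb, if_pos hlt]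
    simp only [RExpr.eval, NExpr.eval, hv, hx, hlabel, h.digit x hxS _ hpred, h.dist]
  · rw [if_neg hb, if_neg hlt, if_pos hb']
    rfl
  · rw [if_neg hb, if_neg hlt, if_neg hb']
    rfl

theorem holds_conflictTest {i : ℕ} (h : I.IsPrepared par s) (hv : s.nat Arr.v 0 0 = v)
    (hx : s.nat Arr.x 0 0 = x) (hxS : x < I.numStates) (hy : s.nat Arr.y 0 0 = y)
    (hyS : y < I.numStates) (hi : s.nat Arr.i 0 0 = i) (hil : i < I.levels) :
    conflictTest.Holds s ↔ Conflict v (par v) (I.state y) (I.state x) i := by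
  rw [conflictTest, BExpr.Holds, BExpr.Holds, holds_natEq]
  simp only [BExpr.Holds, RExpr.eval, NExpr.eval, hv, hx, hy, hi, h.digit x hxS i hil,
    h.digit y hyS i hil, h.parent, h.dist, Fin.val_inj, Conflict, ne_eq]

theorem runs_penaltyProg (hB : I.levels ≤ B) (h : I.IsPrepared par s) (hv : s.nat Arr.v 0 0 = v)
    (hx : s.nat Arr.x 0 0 = x) (hxS : x < I.numStates) (hy : s.nat Arr.y 0 0 = y)
    (hyS : y < I.numStates) : Runs B penaltyProg s fun s' =>
      s'.rat Arr.sum 0 0 = edgePenalty v (par v) (I.state y) (I.state x) := by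
  have hpenalty : edgePenalty v (par v) (I.state y) (I.state x) = ∑ i : Fin I.levels,
      if v ≠ I.root ∧ Conflict v (par v) (I.state y) (I.state x) i then I.big else 0 := by
    by_cases hroot : v = I.root <;> simp [edgePenalty, hroot, Finset.sum_range]
  rw [hpenalty]
  refine Runs.accumulateRat _ h.levels hB fun i s₁ h₁ hi => ?_
  replace h := h.of_agree h₁
  replace hv := (h₁.nat rfl 0 0).trans hv
  have htest := holds_conflictTest h hv ((h₁.nat rfl 0 0).trans hx) hxS
    ((h₁.nat rfl 0 0).trans hy) hyS hi i.2
  rw [BExpr.Holds, BExpr.Holds, holds_natEq, htest]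
  simp only [NExpr.eval, hv, h.root, Fin.val_inj]
  exact ⟨fun hb => (if_pos hb).symm ▸ h.big, fun hb => if_neg hb⟩

theorem runs_sum_children (hB : I.n ≤ B) (h : I.IsPrepared par s) (hv : s.nat Arr.v 0 0 = v)
    (hx : s.nat Arr.x 0 0 = x) :
    Runs B (accumulateRat Arr.sum Arr.u Arr.points childTest
      (.get Arr.msg (var Arr.u) (var Arr.x))) s fun s' => s'.rat Arr.sum 0 0 =
        ∑ c ∈ Finset.univ.erase I.root with par c = v, s.rat Arr.msg c x := by
  have hsum : ∑ c ∈ Finset.univ.erase I.root with par c = v, s.rat Arr.msg c x =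
      ∑ c : Fin I.n, if c ≠ I.root ∧ par c = v then s.rat Arr.msg c x else 0 := by
    rw [← Finset.sum_filter]
    congr 1
    ext c
    simp
  rw [hsum]
  refine Runs.accumulateRat _ h.points hB fun c s₁ h₁ hc => ?_
  replace h := h.of_agree h₁
  rw [childTest, BExpr.Holds, BExpr.Holds, holds_natEq, holds_natEq]
  simp only [RExpr.eval, NExpr.eval, hc, h.root, h.parent, h₁.nat (a := Arr.v) rfl, hv,
    h₁.nat (a := Arr.x) rfl, hx, h₁.rat (a := Arr.msg) rfl, Fin.val_inj]
  exact ⟨fun hb => (if_pos hb).symm, fun hb => if_neg hb⟩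

theorem runs_tableProg (hB : I.n + I.levels + I.numStates ≤ B) (h : I.IsPrepared par s)
    (hv : s.nat Arr.v 0 0 = v) : Runs B tableProg s fun s' =>
      (∀ x < I.numStates, s'.rat Arr.table v x = vertexCost v (I.state x) +
        ∑ c ∈ Finset.univ.erase I.root with par c = v, s.rat Arr.msg c x) ∧
      ∀ v' ≠ (v : ℕ), ∀ x, s'.rat Arr.table v' x = s.rat Arr.table v' x := by
  refine Runs.forLoop (fun j s' => (∀ x < j, s'.rat Arr.table v x = vertexCost v (I.state x) +
      ∑ c ∈ Finset.univ.erase I.root with par c = v, s.rat Arr.msg c x) ∧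
    ∀ v' ≠ (v : ℕ), ∀ x, s'.rat Arr.table v' x = s.rat Arr.table v' x)
    h.numStates (by omega) ⟨fun x hx => absurd hx x.not_lt_zero, fun _ _ _ => rfl⟩
    fun x hxS s₁ h₁ hx ⟨htable, hother⟩ => ?_
  have hs₁ := h.of_agree h₁
  have hv₁ := (h₁.nat rfl 0 0).trans hv
  refine .seq (runs_vertexCostProg (by omega) hs₁ hv₁ hx hxS) fun s₂ h₂ hcost => ?_
  have hv₂ := (h₂.nat rfl 0 0).trans hv₁
  have hx₂ := (h₂.nat rfl 0 0).trans hx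
  refine .seq (runs_sum_children (by omega) (hs₁.of_agree h₂) hv₂ hx₂) fun s₃ h₃ hsum => ?_
  refine .mono (Runs.setRat (x := v) (y := x) (z := vertexCost v (I.state x) +
      ∑ c ∈ Finset.univ.erase I.root with par c = v, s.rat Arr.msg c x)
    ((h₃.nat rfl 0 0).trans hv₂) ((h₃.nat rfl 0 0).trans hx₂) ?_) fun s₄ _ ⟨hset, hkeep⟩ =>
      ⟨Nat.forall_lt_succ_right.2 ⟨fun x' hx' => ?_, hset⟩, fun v' hv' x' => ?_⟩
  · simp only [RExpr.eval, NExpr.eval, hsum, h₃.rat (a := Arr.cost) rfl, hcost,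
      h₂.rat (a := Arr.msg) rfl, h₁.rat (a := Arr.msg) rfl]
  · rw [hkeep _ _ (.inr hx'.ne), h₃.rat rfl, h₂.rat rfl, htable x' hx']
  · rw [hkeep _ _ (.inl hv'), h₃.rat rfl, h₂.rat rfl, hother v' hv']

/-- The entries of row `v` of `best` and `msg` at the state `x` of the parent are correct, given
those of row `v` of `table`. -/
structure IsMessage (I : Problem) (par : Fin I.n → Fin I.n) (s : Store) (v : Fin I.n) (x : ℕ) :
    Prop where
  best_lt : s.nat Arr.best v x < I.numStates
  msg_eq : s.rat Arr.msg v x = s.rat Arr.table v (s.nat Arr.best v x) +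
    edgePenalty v (par v) (I.state (s.nat Arr.best v x)) (I.state x)
  msg_le : ∀ y < I.numStates, s.rat Arr.msg v x ≤ s.rat Arr.table v y +
    edgePenalty v (par v) (I.state y) (I.state x)

theorem IsMessage.congr {s' : Store} (h : I.IsMessage par s v x)
    (hbest : s'.nat Arr.best v x = s.nat Arr.best v x)
    (hmsg : s'.rat Arr.msg v x = s.rat Arr.msg v x)
    (htable : ∀ y, s'.rat Arr.table v y = s.rat Arr.table v y) : I.IsMessage par s' v x where
  best_lt := hbest ▸ h.best_lt
  msg_eq := by rw [hmsg, hbest, htable, h.msg_eq]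
  msg_le y hy := by rw [hmsg, htable]; exact h.msg_le y hy

theorem runs_messageEntryProg (hB : I.n + I.levels + I.numStates ≤ B) (h : I.IsPrepared par s)
    (hv : s.nat Arr.v 0 0 = v) (hx : s.nat Arr.x 0 0 = x) (hxS : x < I.numStates) :
    Runs B messageEntryProg s fun s' => I.IsMessage par s' v x ∧
      ∀ v' x', (v' ≠ (v : ℕ) ∨ x' ≠ x) → s'.nat Arr.best v' x' = s.nat Arr.best v' x' ∧
        s'.rat Arr.msg v' x' = s.rat Arr.msg v' x' := by
  refine .seq (Runs.minimize (fun _ => True) (fun y => s.rat Arr.table v y +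
      edgePenalty v (par v) (I.state y) (I.state x)) h.numStates (by omega) rfl
    fun y hy s₁ h₁ hys => ?_) fun s₁ h₁ ⟨hmem, hval, hmin⟩ => ?_
  · have hyS : y < I.numStates := hy.elim (fun h => h ▸ I.numStates_pos) id
    have hv₁ := (h₁.nat rfl 0 0).trans hv
    refine .mono (runs_penaltyProg (by omega) (h.of_agree h₁) hv₁ ((h₁.nat rfl 0 0).trans hx) hxS
      hys hyS) fun s₂ h₂ hsum => ⟨iff_of_true (holds_always s₂) trivial, ?_⟩
    simp only [RExpr.eval, NExpr.eval, hsum, h₂.nat (a := Arr.v) rfl, hv₁,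
      h₂.nat (a := Arr.y) rfl, hys, h₂.rat (a := Arr.table) rfl, h₁.rat (a := Arr.table) rfl]
  · have harg : s₁.nat Arr.arg 0 0 < I.numStates :=
      hmem.elim (fun h => h ▸ I.numStates_pos) And.left
    have hv₁ := (h₁.nat rfl 0 0).trans hv
    have hx₁ := (h₁.nat rfl 0 0).trans hx
    refine .seq (Runs.setNat hv₁ hx₁ rfl) fun s₂ h₂ ⟨hbest, hkeep⟩ => ?_
    refine .mono (Runs.setRat ((h₂.nat rfl 0 0).trans hv₁) ((h₂.nat rfl 0 0).trans hx₁)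
      (h₂.rat rfl 0 0)) fun s₃ h₃ ⟨hmsg, hkeep'⟩ => ?_
    have hbest₃ : s₃.nat Arr.best v x = s₁.nat Arr.arg 0 0 := (h₃.nat rfl _ _).trans hbest
    have htable : ∀ y, s₃.rat Arr.table v y = s.rat Arr.table v y := fun y => by
      rw [h₃.rat rfl, h₂.rat rfl, h₁.rat rfl]
    refine ⟨⟨hbest₃ ▸ harg, ?_, fun y hy => ?_⟩, fun v' x' hne => ⟨?_, ?_⟩⟩
    · rw [hmsg, hval, htable, hbest₃]
    · rw [hmsg, htable]
      exact hmin y hy trivial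
    · rw [h₃.nat rfl, hkeep v' x' hne, h₁.nat rfl]
    · rw [hkeep' v' x' hne, h₂.rat rfl, h₁.rat rfl]

theorem runs_messageProg (hB : I.n + I.levels + I.numStates ≤ B) (h : I.IsPrepared par s)
    (hv : s.nat Arr.v 0 0 = v) : Runs B messageProg s fun s' =>
      (∀ x < I.numStates, I.IsMessage par s' v x) ∧
      ∀ v' ≠ (v : ℕ), ∀ x, s'.nat Arr.best v' x = s.nat Arr.best v' x ∧
        s'.rat Arr.msg v' x = s.rat Arr.msg v' x := by
  refine Runs.forLoop (fun j s' => (∀ x < j, I.IsMessage par s' v x) ∧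
    ∀ v' ≠ (v : ℕ), ∀ x, s'.nat Arr.best v' x = s.nat Arr.best v' x ∧
      s'.rat Arr.msg v' x = s.rat Arr.msg v' x)
    h.numStates (by omega) ⟨fun x hx => absurd hx x.not_lt_zero, fun _ _ _ => ⟨rfl, rfl⟩⟩
    (fun x hxS s₁ h₁ hx ⟨hmsg, hother⟩ => ?_) (hInv := fun j s' z ⟨hmsg, hother⟩ =>
      ⟨fun x hx => (hmsg x hx).congr rfl rfl fun _ => rfl, hother⟩)
  refine .mono (runs_messageEntryProg hB (h.of_agree h₁) ((h₁.nat rfl 0 0).trans hv) hx hxS)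
    fun s₂ h₂ ⟨hset, hkeep⟩ => ⟨Nat.forall_lt_succ_right.2 ⟨fun x' hx' => ?_, hset⟩,
      fun v' hv' x' => ?_⟩
  · obtain ⟨hbest, hmsg'⟩ := hkeep v x' (.inr hx'.ne)
    exact (hmsg x' hx').congr hbest hmsg' fun y => h₂.rat rfl _ _
  · obtain ⟨hbest, hmsg'⟩ := hkeep v' x' (.inl hv')
    exact ⟨hbest.trans (hother v' hv' x').1, hmsg'.trans (hother v' hv' x').2⟩

/-- The memory contains the result of the elimination of `v`. -/
def HasEliminated (I : Problem) (par : Fin I.n → Fin I.n) (s : Store) (v : Fin I.n) : Prop :=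
  IsEliminated par I.root (Set.Iio I.numStates) (fun v x => vertexCost v (I.state x))
    (fun v y x => edgePenalty v (par v) (I.state y) (I.state x))
    (fun v x => s.rat Arr.table v x) (fun v x => s.nat Arr.best v x)
    (fun v x => s.rat Arr.msg v x) v

theorem HasEliminated.of_agree {p : Prog} {s' : Store} (h : I.HasEliminated par s v)
    (hs : Agree p s s') (hp : (p.keepsRat Arr.table && p.keepsNat Arr.best &&
      p.keepsRat Arr.msg) = true := by rfl) : I.HasEliminated par s' v := by
  simp only [Bool.and_eq_true] at hp
  obtain ⟨⟨htable, hbest⟩, hmsg⟩ := hp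
  exact h.congr (fun _ => hs.rat htable _ _) (fun _ => hs.nat hbest _ _)
    (fun _ => hs.rat hmsg _ _) fun _ _ _ _ => hs.rat hmsg _ _

theorem runs_eliminate_point (hB : I.n + I.levels + I.numStates ≤ B) (hpar : I.IsParentMap par)
    (h : I.IsPrepared par s) (hv : s.nat Arr.v 0 0 = v)
    (hdone : ∀ u, I.rank u < I.rank v → I.HasEliminated par s u) :
    Runs B (.seq tableProg messageProg) s fun s' =>
      ∀ u, I.rank u ≤ I.rank v → I.HasEliminated par s' u := by
  refine .seq (runs_tableProg hB h hv) fun s₁ h₁ ⟨htable, htable'⟩ => .mono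
    (runs_messageProg hB (h.of_agree h₁) ((h₁.nat rfl 0 0).trans hv))
    fun s₂ h₂ ⟨hmsg, hother⟩ u hu => ?_
  have hne : ∀ {c : Fin I.n}, I.rank c < I.rank v → (c : ℕ) ≠ v := fun hlt heq =>
    hlt.ne (congrArg I.rank (Fin.ext heq))
  have hbest' : ∀ c, I.rank c < I.rank v → ∀ x, s₂.nat Arr.best c x = s.nat Arr.best c x :=
    fun c hc x => (hother c (hne hc) x).1.trans (h₁.nat rfl _ _)
  have hmsg' : ∀ c, I.rank c < I.rank v → ∀ x, s₂.rat Arr.msg c x = s.rat Arr.msg c x :=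
    fun c hc x => (hother c (hne hc) x).2.trans (h₁.rat rfl _ _)
  rcases hu.lt_or_eq with hlt | heq
  · refine (hdone u hlt).congr (fun x => ?_) (hbest' u hlt) (hmsg' u hlt) fun c hc hcu =>
      hmsg' c ((hpar.rank_lt hc).trans (hcu ▸ hlt))
    rw [h₂.rat rfl, htable' u (hne hlt)]
  · obtain rfl := I.rank_injective heq
    refine ⟨fun x hx => (hmsg x hx).best_lt, fun x hx => ?_, fun x hx => (hmsg x hx).msg_eq,
      fun x hx => (hmsg x hx).msg_le⟩
    rw [h₂.rat rfl, htable x hx]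
    congr 1
    refine Finset.sum_congr rfl fun c hc => (hmsg' c ?_ x).symm
    obtain ⟨hc, hcu⟩ := Finset.mem_filter.1 hc
    exact hcu ▸ hpar.rank_lt (Finset.ne_of_mem_erase hc)

theorem runs_eliminateProg (hB : I.n + I.levels + I.numStates ≤ B) (hpar : I.IsParentMap par)
    (h : I.IsPrepared par s) :
    Runs B eliminateProg s fun s' => ∀ v, I.HasEliminated par s' v := by
  refine .mono (Runs.forLoop (fun j s => ∀ v, I.rank v < j → I.HasEliminated par s v)
    h.points (by omega) (fun v hv => absurd hv (Nat.not_lt_zero _)) fun j hj s₁ h₁ hjs hdone => ?_)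
    fun s' _ hs' v => hs' v (I.rank_lt v)
  obtain ⟨v, rfl⟩ := I.exists_rank_eq hj
  have hs₁ := h.of_agree h₁
  refine .seq (Runs.assign (z := v) ?_) fun s₂ h₂ hv => ?_
  · simp only [NExpr.eval, hjs, hs₁.order]
  · exact .mono (runs_eliminate_point hB hpar (hs₁.of_agree h₂) hv fun u hu =>
      (hdone u hu).of_agree h₂) fun s₃ _ hs₃ u hu => hs₃ u (Nat.lt_succ_iff.1 hu)

end Problem

/-! ### Reading off the tree -/

/-- The choice of an optimal state for every point, from the root to the leaves. -/
def chooseProg : Prog :=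
  forLoop Arr.j Arr.points (.seq
    (assign Arr.v (.get Arr.order (.lit 0) (.sub (.sub (var Arr.points) (.lit 1)) (var Arr.j))))
    (.seq (.ite (natEq (var Arr.v) (var Arr.root)) (assign Arr.x (.lit 0))
        (assign Arr.x (.get Arr.chosen (.lit 0) parentExpr)))
      (.setNat Arr.chosen (.lit 0) (var Arr.v) (.get Arr.best (var Arr.v) (var Arr.x)))))

/-- The assignment of the indicator of the test `b` to an entry of the array `a`. -/
def setIndicator (a : ℕ) (i j : NExpr) (b : BExpr) : Prog :=
  .ite b (.setNat a i j (.lit 1)) (.setNat a i j (.lit 0))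

/-- The output of the vertices of the tree, and the computation of their parents in it. -/
def verticesProg : Prog :=
  forLoop Arr.v Arr.points (.seq (assign Arr.x (.get Arr.chosen (.lit 0) (var Arr.v)))
    (.seq labelProg (.seq
      (setIndicator Arr.outVerts (var Arr.v) (.lit 0) (.nlt (var Arr.label) (var Arr.levels)))
      (.setNat Arr.link (.lit 0) (var Arr.v)
        (stateExpr (var Arr.x) (.sub (var Arr.label) (.lit 1)))))))

/-- The test whether the point `u` is joined to its parent `v` in the tree. -/
def linkTest (u v : NExpr) : BExpr :=
  .conj (.nlt (.lit 0) (.get Arr.outVerts u (.lit 0)))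
    (.conj (.neg (natEq u (var Arr.root))) (natEq (.get Arr.link (.lit 0) u) v))

/-- The output of the edges of the tree at `u`. -/
def edgesRowProg : Prog :=
  forLoop Arr.v Arr.points (setIndicator Arr.outAdj (var Arr.u) (var Arr.v)
    (disj (linkTest (var Arr.u) (var Arr.v)) (linkTest (var Arr.v) (var Arr.u))))

/-- The output of the edges of the tree. -/
def edgesProg : Prog :=
  forLoop Arr.u Arr.points edgesRowProg

/-- The computation of a `k`-hop Steiner tree of minimum cost on a tree metric. -/
def steinerProg : Prog :=
  .seq preprocessProg (.seq eliminateProg (.seq chooseProg (.seq verticesProg edgesProg)))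

/-- `m` is the indicator of the proposition `P`. -/
def Indicates (P : Prop) (m : ℕ) : Prop :=
  (P ∧ m = 1) ∨ (¬ P ∧ m = 0)

theorem Indicates.pos_iff {P : Prop} {m : ℕ} (h : Indicates P m) : 0 < m ↔ P := by
  rcases h with ⟨hP, rfl⟩ | ⟨hP, rfl⟩ <;> simp [hP]

theorem Runs.setIndicator {B a x y : ℕ} {i j : NExpr} {b : BExpr} {s : Store} {P : Prop}
    (hi : i.eval s = x) (hj : j.eval s = y) (hb : b.Holds s ↔ P) :
    Runs B (setIndicator a i j b) s fun s' => Indicates P (s'.nat a x y) ∧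
      ∀ x' y', (x' ≠ x ∨ y' ≠ y) → s'.nat a x' y' = s.nat a x' y' :=
  .ite (fun h => .mono (.setNat hi hj rfl) fun _ _ ⟨hset, hkeep⟩ => ⟨.inl ⟨hb.1 h, hset⟩, hkeep⟩)
    fun h => .mono (.setNat hi hj rfl) fun _ _ ⟨hset, hkeep⟩ => ⟨.inr ⟨mt hb.2 h, hset⟩, hkeep⟩

namespace Problem

variable {I : Problem} {par : Fin I.n → Fin I.n} {s : Store} {B : ℕ} {u v : Fin I.n}

/-- The state chosen for `v` is the best one for the state chosen for its parent. The root has no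
parent, and any state may take the place of that of its parent; `0` does. -/
structure IsChosen (I : Problem) (par : Fin I.n → Fin I.n) (s : Store) (v : Fin I.n) : Prop where
  lt : s.nat Arr.chosen 0 v < I.numStates
  eq : s.nat Arr.chosen 0 v =
    s.nat Arr.best v (if v = I.root then 0 else s.nat Arr.chosen 0 (par v))

theorem IsChosen.congr {s' : Store} (h : I.IsChosen par s v)
    (hbest : ∀ x, s'.nat Arr.best v x = s.nat Arr.best v x)
    (hself : s'.nat Arr.chosen 0 v = s.nat Arr.chosen 0 v)
    (hpar : v ≠ I.root → s'.nat Arr.chosen 0 (par v) = s.nat Arr.chosen 0 (par v)) :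
    I.IsChosen par s' v where
  lt := hself ▸ h.lt
  eq := by
    rw [hself, hbest, h.eq]
    split_ifs with hv
    exacts [rfl, by rw [hpar hv]]

theorem totalCost_le_of_isChosen (h : ∀ v, I.HasEliminated par s v)
    (hs : ∀ v, I.IsChosen par s v) {τ : Fin I.n → ℕ} (hτ : ∀ v, τ v < I.numStates) :
    totalCost par (fun v : Fin I.n => I.state (s.nat Arr.chosen 0 v)) ≤
      totalCost par (fun v => I.state (τ v)) :=
  IsEliminated.sum_le_sum (τ := fun v : Fin I.n => s.nat Arr.chosen 0 v) h (fun _ _ => if_pos rfl)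
    I.numStates_pos ((hs I.root).eq.trans (by rw [if_pos rfl]))
    (fun v hv => (hs v).eq.trans (by rw [if_neg hv])) (fun v => (hs v).lt) hτ

theorem runs_choose_point (hpar : I.IsParentMap par) (h : I.IsPrepared par s)
    (helim : I.HasEliminated par s v) (hv : s.nat Arr.v 0 0 = v)
    (hdone : ∀ u, I.rank v < I.rank u → I.IsChosen par s u) :
    Runs B (.seq (.ite (natEq (var Arr.v) (var Arr.root)) (assign Arr.x (.lit 0))
        (assign Arr.x (.get Arr.chosen (.lit 0) parentExpr)))
      (.setNat Arr.chosen (.lit 0) (var Arr.v) (.get Arr.best (var Arr.v) (var Arr.x)))) s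
      fun s' => ∀ u, I.rank v ≤ I.rank u → I.IsChosen par s' u := by
  have hparent : Runs B (.ite (natEq (var Arr.v) (var Arr.root)) (assign Arr.x (.lit 0))
      (assign Arr.x (.get Arr.chosen (.lit 0) parentExpr))) s fun s' => s'.nat Arr.x 0 0 =
        if v = I.root then 0 else s.nat Arr.chosen 0 (par v) := by
    have htest : (natEq (var Arr.v) (var Arr.root)).Holds s ↔ v = I.root := by
      rw [holds_natEq]
      simp only [NExpr.eval, hv, h.root, Fin.val_inj]
    refine .ite (fun hb => .assign ?_) fun hb => .assign ?_ <;> rw [htest] at hb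
    · rw [if_pos hb, NExpr.eval]
    · simp only [if_neg hb, NExpr.eval, hv, h.parent]
  refine .seq hparent fun s₁ h₁ hx => ?_
  refine .mono (Runs.setNat (x := 0) (y := v) (z := s.nat Arr.best v
      (if v = I.root then 0 else s.nat Arr.chosen 0 (par v))) rfl ((h₁.nat rfl 0 0).trans hv) ?_)
    fun s₂ h₂ ⟨hset, hkeep⟩ u hu => ?_
  · simp only [NExpr.eval, h₁.nat (a := Arr.v) rfl, hv, hx, h₁.nat (a := Arr.best) rfl]
  have hbest : ∀ u : Fin I.n, ∀ x, s₂.nat Arr.best u x = s.nat Arr.best u x := fun u x => by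
    rw [h₂.nat rfl, h₁.nat rfl]
  have hkeep' : ∀ u, I.rank v < I.rank u → s₂.nat Arr.chosen 0 u = s.nat Arr.chosen 0 u :=
    fun u hu => (hkeep 0 u (.inr fun heq => hu.ne' (congrArg I.rank (Fin.ext heq)))).trans
      (h₁.nat rfl _ _)
  rcases hu.lt_or_eq with hlt | heq
  · exact (hdone u hlt).congr (hbest u) (hkeep' u hlt) fun hu =>
      hkeep' _ (hlt.trans (hpar.rank_lt hu))
  · obtain rfl := I.rank_injective heq
    refine ⟨hset ▸ helim.best_mem _ ?_, ?_⟩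
    · split_ifs with hv
      exacts [I.numStates_pos, (hdone _ (hpar.rank_lt hv)).lt]
    · rw [hset, hbest]
      split_ifs with hv
      exacts [rfl, by rw [hkeep' _ (hpar.rank_lt hv)]]

theorem runs_chooseProg (hB : I.n ≤ B) (hpar : I.IsParentMap par) (h : I.IsPrepared par s)
    (helim : ∀ v, I.HasEliminated par s v) :
    Runs B chooseProg s fun s' => ∀ v, I.IsChosen par s' v := by
  refine .mono (Runs.forLoop (fun j s => ∀ v, I.n ≤ I.rank v + j → I.IsChosen par s v) h.points hB
    (fun v hv => absurd hv (I.rank_lt v).not_ge) (fun j hj s₁ h₁ hjs hdone => ?_)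
    (hInv := fun j s' z h v hv => (h v hv).congr (fun _ => rfl) rfl fun _ => rfl))
    fun s' _ hs' v => hs' v (Nat.le_add_left _ _)
  obtain ⟨v, hv⟩ := I.exists_rank_eq (j := I.n - 1 - j) (by omega)
  have hs₁ := h.of_agree h₁
  refine .seq (Runs.assign (z := v) ?_) fun s₂ h₂ hvs => ?_
  · simp only [NExpr.eval, hjs, hs₁.points, ← hv, hs₁.order]
  · refine .mono (runs_choose_point hpar (hs₁.of_agree h₂)
      (((helim v).of_agree h₁).of_agree h₂) hvs fun u hu => (hdone u (by omega)).congr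
        (fun x => h₂.nat rfl _ _) (h₂.nat rfl _ _) fun _ => h₂.nat rfl _ _)
      fun s₃ _ hs₃ u hu => hs₃ u (by omega)

/-- The memory contains the vertices and the parents of the tree given by the assignment `σ`. -/
structure HasLinks (I : Problem) (σ : Fin I.n → ℕ → Fin I.n) (s : Store) : Prop where
  mem : ∀ v : Fin I.n, Indicates (v ∈ used σ) (s.nat Arr.outVerts v 0)
  link : ∀ v : Fin I.n, s.nat Arr.link 0 v = link σ v

theorem HasLinks.of_agree {σ : Fin I.n → ℕ → Fin I.n} {p : Prog} {s' : Store}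
    (h : I.HasLinks σ s) (hs : Agree p s s')
    (hp : (p.keepsNat Arr.outVerts && p.keepsNat Arr.link) = true := by rfl) :
    I.HasLinks σ s' := by
  obtain ⟨hverts, hlink⟩ := Bool.and_eq_true_iff.1 hp
  exact ⟨fun v => (hs.nat hverts v 0).symm ▸ h.mem v, fun v => (hs.nat hlink 0 v).trans (h.link v)⟩

theorem runs_verticesProg {σ : Fin I.n → ℕ → Fin I.n} (hB : I.n + I.levels ≤ B)
    (h : I.IsPrepared par s)
    (hσ : ∀ v : Fin I.n, s.nat Arr.chosen 0 v < I.numStates ∧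
      I.state (s.nat Arr.chosen 0 v) = σ v) :
    Runs B verticesProg s (I.HasLinks σ) := by
  refine .mono (Runs.forLoop (fun j s => ∀ v : Fin I.n, v < j →
      Indicates (v ∈ used σ) (s.nat Arr.outVerts v 0) ∧ s.nat Arr.link 0 v = link σ v)
    h.points (by omega) (fun v hv => absurd hv (Nat.not_lt_zero _)) fun j hj s₁ h₁ hjs hInv => ?_)
    fun s' _ hs' => ⟨fun v => (hs' v v.2).1, fun v => (hs' v v.2).2⟩
  obtain ⟨v, rfl⟩ : ∃ v : Fin I.n, (v : ℕ) = j := ⟨⟨j, hj⟩, rfl⟩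
  obtain ⟨hxS, hx⟩ := hσ v
  have hs₁ := h.of_agree h₁
  refine .seq (Runs.assign (z := s.nat Arr.chosen 0 v) ?_) fun s₂ h₂ hxs => ?_
  · simp only [NExpr.eval, hjs, h₁.nat (a := Arr.chosen) rfl]
  have hv₂ := (h₂.nat rfl 0 0).trans hjs
  have hs₂ := hs₁.of_agree h₂
  refine .seq (runs_labelProg (by omega) hs₂ hv₂ hxs hxS) fun s₃ h₃ hlabel => ?_
  have hs₃ := hs₂.of_agree h₃
  have hv₃ := (h₃.nat rfl 0 0).trans hv₂
  rw [hx] at hlabel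
  refine .seq (Runs.setIndicator (P := v ∈ used σ) (y := 0) hv₃ rfl ?_)
    fun s₄ h₄ ⟨hset, hkeep⟩ => ?_
  · simp only [BExpr.Holds, NExpr.eval, hlabel, hs₃.levels, mem_used]
  refine .mono (Runs.setNat (x := 0) (y := v) (z := link σ v) rfl ((h₄.nat rfl 0 0).trans hv₃) ?_)
    fun s₅ h₅ ⟨hset', hkeep'⟩ w hw => ?_
  · have hlt : label v (σ v) - 1 < I.levels := by
      have := label_le_levels v (σ v)
      have := I.levels_pos
      omega
    simp only [NExpr.eval, h₄.nat (a := Arr.label) rfl, hlabel, h₄.nat (a := Arr.x) rfl,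
      h₃.nat (a := Arr.x) rfl, hxs, (hs₃.of_agree h₄).digit _ hxS _ hlt, hx, link]
  · rw [h₅.nat rfl]
    rcases Nat.lt_succ_iff_lt_or_eq.1 hw with hlt | heq
    · rw [hkeep _ _ (.inl hlt.ne), hkeep' _ _ (.inr hlt.ne), h₄.nat (a := Arr.link) rfl,
        h₃.nat rfl, h₃.nat rfl, h₂.nat rfl, h₂.nat rfl]
      exact hInv w hlt
    · obtain rfl := Fin.ext heq
      exact ⟨hset, hset'⟩

/-- The point `v` is the parent of `u` in the tree given by the assignment `σ`. -/
def IsLink (σ : Fin I.n → ℕ → Fin I.n) (u v : Fin I.n) : Prop :=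
  u ∈ used σ ∧ u ≠ I.root ∧ link σ u = v

theorem holds_linkTest {σ : Fin I.n → ℕ → Fin I.n} {e f : NExpr} (h : I.IsLoaded s)
    (hσ : I.HasLinks σ s) (hu : e.eval s = u) (hv : f.eval s = v) :
    (linkTest e f).Holds s ↔ IsLink σ u v := by
  refine and_congr ?_ (and_congr (not_congr (holds_natEq.trans ?_)) (holds_natEq.trans ?_)) <;>
    simp only [BExpr.Holds, NExpr.eval, hu, hv, h.root, hσ.link, (hσ.mem u).pos_iff, Fin.val_inj]

theorem runs_edgesRowProg {σ : Fin I.n → ℕ → Fin I.n} (hB : I.n ≤ B) (h : I.IsLoaded s)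
    (hσ : I.HasLinks σ s) (hu : s.nat Arr.u 0 0 = u) : Runs B edgesRowProg s fun s' =>
      (∀ v : Fin I.n, Indicates (IsLink σ u v ∨ IsLink σ v u) (s'.nat Arr.outAdj u v)) ∧
      ∀ u' ≠ (u : ℕ), ∀ v, s'.nat Arr.outAdj u' v = s.nat Arr.outAdj u' v := by
  refine .mono (Runs.forLoop (fun j s' => (∀ v : Fin I.n, v < j →
      Indicates (IsLink σ u v ∨ IsLink σ v u) (s'.nat Arr.outAdj u v)) ∧
      ∀ u' ≠ (u : ℕ), ∀ v, s'.nat Arr.outAdj u' v = s.nat Arr.outAdj u' v) h.points hB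
    ⟨fun v hv => absurd hv (Nat.not_lt_zero _), fun _ _ _ => rfl⟩
    fun j hj s₁ h₁ hjs ⟨hrow, hother⟩ => ?_)
    fun s' _ ⟨hrow, hother⟩ => ⟨fun v => hrow v v.2, hother⟩
  obtain ⟨v, rfl⟩ : ∃ v : Fin I.n, (v : ℕ) = j := ⟨⟨j, hj⟩, rfl⟩
  have hs₁ := h.of_agree h₁
  have hσ₁ := hσ.of_agree h₁
  have hu₁ := (h₁.nat rfl 0 0).trans hu
  refine .mono (Runs.setIndicator hu₁ hjs (holds_disj.trans
    (or_congr (holds_linkTest hs₁ hσ₁ hu₁ hjs) (holds_linkTest hs₁ hσ₁ hjs hu₁))))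
    fun s₂ _ ⟨hset, hkeep⟩ => ⟨fun w hw => ?_, fun u' hu' w => ?_⟩
  · rcases Nat.lt_succ_iff_lt_or_eq.1 hw with hlt | heq
    · rw [hkeep _ _ (.inr hlt.ne)]
      exact hrow w hlt
    · obtain rfl := Fin.ext heq
      exact hset
  · rw [hkeep _ _ (.inl hu'), hother u' hu']

theorem runs_edgesProg {σ : Fin I.n → ℕ → Fin I.n} (hB : I.n ≤ B) (h : I.IsLoaded s)
    (hσ : I.HasLinks σ s) : Runs B edgesProg s fun s' => ∀ u v : Fin I.n,
      Indicates (IsLink σ u v ∨ IsLink σ v u) (s'.nat Arr.outAdj u v) := by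
  refine .mono (Runs.forLoop (fun j s' => ∀ u : Fin I.n, u < j → ∀ v : Fin I.n,
      Indicates (IsLink σ u v ∨ IsLink σ v u) (s'.nat Arr.outAdj u v)) h.points hB
    (fun v hv => absurd hv (Nat.not_lt_zero _)) fun j hj s₁ h₁ hjs hInv => ?_)
    fun s' _ hs' u => hs' u u.2
  obtain ⟨u, rfl⟩ : ∃ u : Fin I.n, (u : ℕ) = j := ⟨⟨j, hj⟩, rfl⟩
  refine .mono (runs_edgesRowProg hB (h.of_agree h₁) (hσ.of_agree h₁) hjs)
    fun s₂ _ ⟨hrow, hother⟩ w hw => ?_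
  rcases Nat.lt_succ_iff_lt_or_eq.1 hw with hlt | heq
  · intro v
    rw [hother _ hlt.ne]
    exact hInv w hlt v
  · obtain rfl := Fin.ext heq
    exact hrow

theorem runs_steinerProg (I : Problem) (ht : IsTreeMetric I.dist) :
    Runs (I.n + I.levels + I.numStates) steinerProg I.input fun s =>
      ∃ T : (⊤ : SimpleGraph (Fin I.n)).Subgraph, I.IsOutput s T ∧ I.IsOptimal T := by
  refine .seq (runs_preprocessProg le_rfl I.isLoaded_input) fun s₁ _ ⟨par, hpar, h₁⟩ => ?_
  refine .seq (runs_eliminateProg le_rfl hpar h₁) fun s₂ a₂ helim => ?_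
  have h₂ := h₁.of_agree a₂
  refine .seq (runs_chooseProg (by omega) hpar h₂ helim) fun s₃ a₃ hchosen => ?_
  have h₃ := h₂.of_agree a₃
  have helim₃ := fun v => (helim v).of_agree a₃
  obtain ⟨harb, hopt⟩ := isOptimal_of_forall_totalCost_le hpar ht
    fun τ hτ => totalCost_le_of_isChosen helim₃ hchosen hτ
  refine .seq (runs_verticesProg (by omega) h₃ fun v => ⟨(hchosen v).lt, rfl⟩)
    fun s₄ a₄ hlinks => ?_
  exact .mono (runs_edgesProg (by omega) (h₃.of_agree a₄).toIsLoaded hlinks) fun s₅ a₅ hadj =>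
    ⟨harb.toSubgraph, ⟨(hlinks.of_agree a₅).mem, hadj⟩, hopt⟩

/-! ### Running time -/

theorem add_levels_add_numStates_le (I : Problem) :
    I.n + I.levels + I.numStates ≤ 4 * I.n ^ (2 * I.k) := by
  have hn : 1 ≤ I.n := Fin.pos I.root
  have hk := I.one_le_k
  have hlevels : I.levels ≤ I.n + 1 := Nat.succ_le_succ (min_le_right _ _)
  have h1 : I.n ≤ I.n ^ (2 * I.k) := Nat.le_self_pow (by omega) _
  have h2 : I.numStates ≤ I.n ^ (2 * I.k) :=
    Nat.pow_le_pow_right hn (I.levels_le.trans (by omega))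
  omega

end Problem

theorem Prog.exists_time_le_pow (p : Prog) : ∃ C, ∀ I : Problem,
    p.time (I.n + I.levels + I.numStates) ≤ C * I.n ^ (C * I.k) := by
  obtain ⟨C, hC⟩ := p.exists_time_le
  refine ⟨C * 4 ^ C + 2 * C, fun I => ?_⟩
  have hn : 1 ≤ I.n := Fin.pos I.root
  calc p.time (I.n + I.levels + I.numStates)
      ≤ C * (I.n + I.levels + I.numStates) ^ C := hC _ (by omega)
    _ ≤ C * (4 * I.n ^ (2 * I.k)) ^ C := by gcongr; exact I.add_levels_add_numStates_le
    _ = C * 4 ^ C * I.n ^ (2 * C * I.k) := by rw [mul_pow, ← pow_mul]; ring_nf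
    _ ≤ (C * 4 ^ C + 2 * C) * I.n ^ ((C * 4 ^ C + 2 * C) * I.k) := by
      gcongr <;> omega

end KHop

/-- On tree metrics, the minimum-cost `k`-hop Steiner tree problem is solved exactly in
time `n ^ O(k)`, by one program for all `n` and `k`. -/
theorem theorem4 :
    ∃ (P : KHop.Prog) (C : ℕ), ∀ I : KHop.Problem, KHop.IsTreeMetric I.dist →
      ∃ (t : ℕ) (s : KHop.Store), KHop.Exec P I.input t s ∧ t ≤ C * I.n ^ (C * I.k) ∧
        ∃ T : (⊤ : SimpleGraph (Fin I.n)).Subgraph, I.IsOutput s T ∧ I.IsOptimal T := by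
  obtain ⟨C, hC⟩ := KHop.steinerProg.exists_time_le_pow
  refine ⟨KHop.steinerProg, C, fun I ht => ?_⟩
  obtain ⟨t, s, hexec, htime, hs⟩ := I.runs_steinerProg ht
  exact ⟨t, s, hexec, htime.trans (hC I), hs⟩
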